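/- Let $p$ be a prime with $p \equiv 1 \pmod{30}$, let $A_5$ be the alternating group on five letters, and let $\mathbb{Z}_p$ be the cyclic group of order $p$. Then every connected Cayley graph on the direct product $A_5 \times \mathbb{Z}_p$ has a hamiltonian cycle. Here, for a finite group $G$ and a subset $S \subseteq G$, the Cayley graph $\mathrm{Cay}(G;S)$ is the graph whose vertices are the elements of $G$, with an edge joining $g$ to $gs$ and an edge joining $g$ to $gs^{-1}$ for each $g \in G$ and $s \in S$; a hamiltonian cycle is a cycle that visits every vertex exactly once. -/

import Mathlib

open Equiv

/-! ### Hamiltonian cycles from closed injective sequences -/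

/-! Write Z for the cyclic group of order p. A hamiltonian cycle of a Cayley graph on A_5, spelled
as a word in the first components of elements of S, lifts to a walk in A_5 × Z from the identity to
a central element (1, z). If z ≠ 1, running through the lifted word p times gives a hamiltonian
cycle (`SimpleGraph.mulCayley_hamiltonian_of_wordProd_ne_one`). Since S generates, some s in S has a
nontrivial component in Z. When s.1 ≠ 1, the aim is a cyclic word in s.1 and at most two further
generators for which z ≠ 1, whatever the Z-components of the other generators are.

There are two sources of such words. If s.1 is an involution, replacing one letter s by its inverse
does not change the cycle in A_5 but changes z by a square of s.2 (`detects_of_flip`). In general z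
depends only on the exponent sums of the word. If the sums of the other generators vanish, for one
word or for an integer combination of two, what remains is s.2 ^ D; here D divides the product of
the primes below 30, whereas p ≥ 31 (`detects_of_net`).

Conjugation in A_5 reduces s.1 to four representatives (`exists_conj_eq`), and the maximal subgroups
above each representative tell which second and third generators can be found in a generating set.
Explicit lists of words, checked by the kernel, settle all these pairs and triples.

Two situations use cosets of ⟨s⟩ instead. If s.1 has order three and its partner is an involution
with trivial Z-component, ⟨s⟩ has order 3p and one special word visits its cosets
(`SimpleGraph.mulCayley_hamiltonian_of_blocks`). If s.1 = 1, then s is central and any cyclic word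
visits the cosets (`SimpleGraph.mulCayley_hamiltonian_of_central`). -/

theorem SimpleGraph.exists_isHamiltonianCycle_of_cyclic_enumeration {V : Type*} [Fintype V]
    [DecidableEq V] (H : SimpleGraph V) (n : ℕ) (hn : 3 ≤ n) (hcard : n = Fintype.card V)
    (f : ℕ → V) (hinj : ∀ i < n, ∀ j < n, f i = f j → i = j)
    (hadj : ∀ i, i + 1 < n → H.Adj (f i) (f (i + 1))) (hlast : H.Adj (f (n - 1)) (f 0)) :
    ∃ (v : V) (C : H.Walk v v), C.IsHamiltonianCycle := by
  have key : ∀ m < n, ∃ p : H.Walk (f 0) (f m),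
      p.support = (List.range (m + 1)).map f := by
    intro m
    induction m with
    | zero => intro _; exact ⟨.nil, by simp⟩
    | succ k ih =>
      intro hk
      obtain ⟨p, hp⟩ := ih (by omega)
      exact ⟨p.concat (hadj k hk), by
        rw [SimpleGraph.Walk.support_concat, hp, List.range_succ (n := k + 1)]; simp⟩
  obtain ⟨p, hp⟩ := key (n - 1) (by omega)
  rw [show n - 1 + 1 = n by omega] at hp
  have hnodup : p.support.Nodup := by
    rw [hp]
    refine List.Nodup.map_on ?_ List.nodup_range
    intro i hi j hj h
    exact hinj i (List.mem_range.1 hi) j (List.mem_range.1 hj) h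
  have hpath : p.IsPath := SimpleGraph.Walk.IsPath.mk' hnodup
  have hlen : p.length = n - 1 := by
    have := congrArg List.length hp
    simp at this
    omega
  refine ⟨_, .cons hlast p, ?_⟩
  have htail : (SimpleGraph.Walk.cons hlast p).tail.IsHamiltonian := by
    rw [SimpleGraph.Walk.isHamiltonian_iff_isPath_and_length_eq]
    simp only [SimpleGraph.Walk.tail_cons]
    refine ⟨by simpa using hpath, by simp [hlen, hcard]⟩
  refine ⟨?_, htail⟩
  rw [SimpleGraph.Walk.cons_isCycle_iff]
  refine ⟨hpath, fun he => ?_⟩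
  -- A path containing the edge between its own ends has length one, but here the length is `n - 1 ≥
  -- 2`.
  have h1 := hpath.length_eq_one_of_mem_edges (by rwa [Sym2.eq_swap])
  omega

theorem SimpleGraph.mulCayley_hamiltonian_of_enumeration {G : Type*} [Group G] [Fintype G]
    [DecidableEq G] (S : Set G) (n : ℕ) (hn : 3 ≤ n) (hcard : n = Fintype.card G) (f : ℕ → G)
    (hinj : ∀ i < n, ∀ j < n, f i = f j → i = j)
    (hadj : ∀ i, i + 1 < n → ((f i)⁻¹ * f (i + 1) ∈ S ∨ (f (i + 1))⁻¹ * f i ∈ S))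
    (hlast : (f (n - 1))⁻¹ * f 0 ∈ S ∨ (f 0)⁻¹ * f (n - 1) ∈ S) :
    ∃ (v : G) (C : (SimpleGraph.mulCayley S).Walk v v), C.IsHamiltonianCycle := by
  refine exists_isHamiltonianCycle_of_cyclic_enumeration _ n hn hcard f hinj ?_ ?_
  · intro i hi
    refine (SimpleGraph.mulCayley_adj _ _ _).2 ⟨fun h => ?_, hadj i hi⟩
    have := hinj i (by omega) (i + 1) hi h
    omega
  · refine (SimpleGraph.mulCayley_adj _ _ _).2 ⟨fun h => ?_, hlast⟩
    have := hinj (n - 1) (by omega) 0 (by omega) h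
    omega

/-- Traversing all left cosets of `⟨b⟩` one after the other, each of them in full. -/
theorem SimpleGraph.mulCayley_hamiltonian_of_cosets {G : Type*} [Group G] [Fintype G]
    [DecidableEq G] (S : Set G) (b : G) (hb : b ∈ S) (n m : ℕ) (hn : 3 ≤ n) (hm : 0 < m)
    (hord : orderOf b = n) (hcard : n * m = Fintype.card G) (t Q : ℕ → G) (ε : ℕ → ℤ)
    (hε : ∀ j, ε j = 1 ∨ ε j = -1) (ht : ∀ j < m, t j ∈ S ∨ (t j)⁻¹ ∈ S)
    (hQ : ∀ j < m, Q (j + 1) = Q j * t j * b ^ (-ε j)) (hclose : Q m = Q 0)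
    (hcoset : ∀ i < m, ∀ j < m, (Q i * t i)⁻¹ * (Q j * t j) ∈ Subgroup.zpowers b → i = j) :
    ∃ (v : G) (C : (SimpleGraph.mulCayley S).Walk v v), C.IsHamiltonianCycle := by
  have hn0 : 0 < n := by omega
  -- Coset `j` is entered at `P j` and left at `Q (j + 1)`: after `n - 1` steps by `b ^ ε j` the
  -- total displacement is `b ^ (-ε j)`, because `b ^ n = 1`.
  set P : ℕ → G := fun j => Q j * t j with hP
  have hend : ∀ j < m, P j * b ^ (ε j * ((n - 1 : ℕ) : ℤ)) = Q (j + 1) := by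
    intro j hj
    rw [hQ j hj]
    congr 1
    have hbn : b ^ (n : ℤ) = 1 := by rw [zpow_natCast, ← hord, pow_orderOf_eq_one]
    have : ε j * ((n - 1 : ℕ) : ℤ) = (n : ℤ) * ε j + (-ε j) := by
      rw [Nat.cast_sub (by omega)]; push_cast; ring
    rw [this, zpow_add, zpow_mul, hbn, one_zpow, one_mul]
  have hnext : ∀ j < m, (Q j)⁻¹ * P j ∈ S ∨ (P j)⁻¹ * Q j ∈ S := by
    intro j hj
    simpa [hP] using ht j hj
  have hlast : n * m - 1 = n * (m - 1) + (n - 1) := by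
    obtain ⟨k, rfl⟩ : ∃ k, m = k + 1 := ⟨m - 1, by omega⟩
    simp only [Nat.add_sub_cancel, Nat.mul_succ]; omega
  refine mulCayley_hamiltonian_of_enumeration S (n * m)
    (le_trans hn (Nat.le_mul_of_pos_right n hm)) hcard
    (fun k => P (k / n) * b ^ (ε (k / n) * ((k % n : ℕ) : ℤ))) ?_ ?_ ?_
  · intro i hi j hj h
    have hi' : i / n < m := Nat.div_lt_of_lt_mul hi
    have hj' : j / n < m := Nat.div_lt_of_lt_mul hj
    have hd : i / n = j / n := by
      refine hcoset _ hi' _ hj' ?_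
      change (P (i / n))⁻¹ * P (j / n) ∈ _
      refine ⟨ε (i / n) * ((i % n : ℕ) : ℤ) - ε (j / n) * ((j % n : ℕ) : ℤ), ?_⟩
      simp only [zpow_sub]
      rw [eq_inv_mul_iff_mul_eq, ← mul_assoc, h]
      group
    rw [hd] at h
    have h2 := mul_left_cancel h
    rw [zpow_eq_zpow_iff_modEq, hord] at h2
    have h3 : ((i % n : ℕ) : ℤ) ≡ ((j % n : ℕ) : ℤ) [ZMOD n] := by
      rcases hε (j / n) with h' | h'
      · simpa [h'] using h2
      · rw [h'] at h2; simpa using h2.neg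
    have h4 : i % n = j % n := by
      have := (Int.natCast_modEq_iff.1 h3)
      unfold Nat.ModEq at this
      simpa using this
    rw [← Nat.div_add_mod i n, ← Nat.div_add_mod j n, hd, h4]
  · intro k hk
    by_cases hr : k % n + 1 < n
    · have hd : (k + 1) / n = k / n := by
        rw [Nat.succ_div, if_neg]; rfl
        intro hdvd
        have : (k + 1) % n = 0 := Nat.mod_eq_zero_of_dvd hdvd
        rw [Nat.add_mod, Nat.mod_eq_of_lt (show 1 < n by omega), Nat.mod_eq_of_lt hr] at this
        omega
      have hmod : (k + 1) % n = k % n + 1 := by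
        rw [Nat.add_mod, Nat.mod_eq_of_lt (show 1 < n by omega), Nat.mod_eq_of_lt hr]
      simp only [hd, hmod]
      rcases hε (k / n) with h' | h' <;> rw [h']
      · left
        convert hb using 1
        push_cast
        rw [mul_inv_rev, mul_assoc, inv_mul_cancel_left, one_mul, one_mul, zpow_add]
        group
      · right
        convert hb using 1
        push_cast
        rw [mul_inv_rev, mul_assoc, inv_mul_cancel_left, ← zpow_neg, ← zpow_add]
        ring_nf
        simp
    · have hr' : k % n = n - 1 := by have := Nat.mod_lt k hn0; omega
      have hk' : k + 1 = n * (k / n + 1) := by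
        have := Nat.div_add_mod k n
        rw [Nat.mul_succ]; omega
      have hd : (k + 1) / n = k / n + 1 := by rw [hk', Nat.mul_div_cancel_left _ hn0]
      have hmod : (k + 1) % n = 0 := by rw [hk', Nat.mul_mod_right]
      have hlt : k / n + 1 < m := by
        rw [hk'] at hk
        exact lt_of_mul_lt_mul_left hk (Nat.zero_le _)
      simp only [hd, hmod, hr', Nat.cast_zero, mul_zero, zpow_zero, mul_one]
      rw [hend _ (by omega)]
      exact hnext _ hlt
  · simp only [Nat.zero_div, Nat.zero_mod, Nat.cast_zero, mul_zero, zpow_zero, mul_one]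
    have hd : (n * m - 1) / n = m - 1 := by
      rw [hlast, Nat.mul_add_div hn0, Nat.div_eq_of_lt (by omega), add_zero]
    have hmod : (n * m - 1) % n = n - 1 := by
      rw [hlast, Nat.mul_add_mod, Nat.mod_eq_of_lt (by omega)]
    rw [hd, hmod, hend _ (by omega), show m - 1 + 1 = m by omega, hclose]
    exact hnext 0 hm

/-! ### Words in at most three generators -/

/-- The value of a letter: `0, 1, 2, 3, 4` stand for `g 0, (g 0)⁻¹, g 1, (g 1)⁻¹, g 2`, and every
other letter for `(g 2)⁻¹`. -/
def letterVal {H : Type*} [Group H] (g : ℕ → H) : ℕ → H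
  | 0 => g 0
  | 1 => (g 0)⁻¹
  | 2 => g 1
  | 3 => (g 1)⁻¹
  | 4 => g 2
  | _ => (g 2)⁻¹

/-- The product of the first `n` letters of the word `w`. -/
def wordProd {H : Type*} [Group H] (g : ℕ → H) (w : ℕ → ℕ) : ℕ → H
  | 0 => 1
  | n + 1 => wordProd g w n * letterVal g (w n)

theorem wordProd_succ {H : Type*} [Group H] (g : ℕ → H) (w : ℕ → ℕ) (n : ℕ) :
    wordProd g w (n + 1) = wordProd g w n * letterVal g (w n) := rfl

theorem map_letterVal {H K : Type*} [Group H] [Group K] (φ : H →* K) (g : ℕ → H) (l : ℕ) :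
    letterVal (fun i => φ (g i)) l = φ (letterVal g l) := by
  unfold letterVal; split <;> simp

theorem map_wordProd {H K : Type*} [Group H] [Group K] (φ : H →* K) (g : ℕ → H) (w : ℕ → ℕ)
    (n : ℕ) : wordProd (fun i => φ (g i)) w n = φ (wordProd g w n) := by
  induction n with
  | zero => simp [wordProd]
  | succ n ih => simp [wordProd, ih, map_letterVal]

theorem letterVal_mem {H : Type*} [Group H] (S : Set H) (g : ℕ → H) (hg : ∀ i, g i ∈ S) (l : ℕ) :
    letterVal g l ∈ S ∨ (letterVal g l)⁻¹ ∈ S := by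
  unfold letterVal; split <;> simp [hg]

theorem letterVal_step {H : Type*} [Group H] (S : Set H) (g : ℕ → H) (hg : ∀ i, g i ∈ S) (x : H)
    (l : ℕ) : x⁻¹ * (x * letterVal g l) ∈ S ∨ (x * letterVal g l)⁻¹ * x ∈ S := by
  simpa using letterVal_mem S g hg l

/-- The first `n` letters of `w` spell a closed walk whose `n` vertices are distinct. -/
def IsCyclicWord {H : Type*} [Group H] (n : ℕ) (g : ℕ → H) (w : ℕ → ℕ) : Prop :=
  (∀ i < n, ∀ j < n, wordProd g w i = wordProd g w j → i = j) ∧ wordProd g w n = 1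

theorem IsCyclicWord.map_equiv {H K : Type*} [Group H] [Group K] {n : ℕ} {g : ℕ → H}
    {w : ℕ → ℕ} (h : IsCyclicWord n g w) (φ : H ≃* K) :
    IsCyclicWord n (fun i => φ (g i)) w := by
  have hm : ∀ i, wordProd (fun i => φ (g i)) w i = φ (wordProd g w i) :=
    map_wordProd φ.toMonoidHom g w
  refine ⟨fun i hi j hj hij => h.1 i hi j hj ?_, ?_⟩
  · rw [hm, hm] at hij; exact φ.injective hij
  · rw [hm, h.2, map_one]

/-- A cyclic word stays cyclic if letters are replaced by letters with the same value. -/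
theorem IsCyclicWord.congr {H : Type*} [Group H] {n : ℕ} {g : ℕ → H}
    {w w' : ℕ → ℕ} (h : IsCyclicWord n g w)
    (hw : ∀ i, letterVal g (w' i) = letterVal g (w i)) : IsCyclicWord n g w' := by
  have hm : ∀ i, wordProd g w' i = wordProd g w i := by
    intro i
    induction i with
    | zero => rfl
    | succ i ih => simp [wordProd, ih, hw]
  simpa [IsCyclicWord, hm] using h

/-! ### Lifting cyclic words to the product with a group of prime order -/

/-- The Factor Group Lemma for `H × Z`, where `Z` has prime order. -/
theorem SimpleGraph.mulCayley_hamiltonian_of_wordProd_ne_one {H Z : Type*} [Group H] [CommGroup Z]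
    [Fintype H] [Fintype Z] [DecidableEq H] [DecidableEq Z] (p : ℕ) [Fact p.Prime]
    (hZ : Fintype.card Z = p) (hH : 3 ≤ Fintype.card H) (S : Set (H × Z)) (γ : ℕ → H × Z)
    (hγ : ∀ i, γ i ∈ S) (w : ℕ → ℕ)
    (hw : IsCyclicWord (Fintype.card H) (fun i => (γ i).1) w)
    (hne : wordProd (fun i => (γ i).2) w (Fintype.card H) ≠ 1) :
    ∃ (v : H × Z) (C : (SimpleGraph.mulCayley S).Walk v v), C.IsHamiltonianCycle := by
  have hp : p.Prime := Fact.out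
  set n := Fintype.card H with hn
  have hn0 : 0 < n := by omega
  have h1 : ∀ i, wordProd (fun i => (γ i).1) w i = (wordProd γ w i).1 :=
    map_wordProd (MonoidHom.fst H Z) γ w
  have h2 : ∀ i, wordProd (fun i => (γ i).2) w i = (wordProd γ w i).2 :=
    map_wordProd (MonoidHom.snd H Z) γ w
  -- One full turn of the lifted word. It is trivial in `H` and has order `p` in `Z`, so the powers
  -- of `T` separate the `p` turns while the prefixes of `w` separate the vertices of one turn.
  set T := wordProd γ w n with hT
  have hT1 : T.1 = 1 := by rw [hT, ← h1]; exact hw.2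
  have hT2 : T.2 ≠ 1 := by rw [hT, ← h2]; exact hne
  have hordT : orderOf T.2 = p := by
    have hdvd : orderOf T.2 ∣ p := hZ ▸ orderOf_dvd_card
    rcases (Nat.dvd_prime hp).1 hdvd with h | h
    · exact absurd (orderOf_eq_one_iff.1 h) hT2
    · exact h
  have hlast : p * n - 1 = n * (p - 1) + (n - 1) := by
    obtain ⟨k, rfl⟩ : ∃ k, p = k + 1 := ⟨p - 1, by have := hp.pos; omega⟩
    simp only [Nat.add_sub_cancel]
    rw [Nat.mul_comm, Nat.mul_succ]; omega
  refine mulCayley_hamiltonian_of_enumeration S (p * n) ?_ ?_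
    (fun k => T ^ (k / n) * wordProd γ w (k % n)) ?_ ?_ ?_
  · exact le_trans hH (Nat.le_mul_of_pos_left n hp.pos)
  · rw [Fintype.card_prod, hZ, Nat.mul_comm]
  · intro i hi j hj h
    have hfst := congrArg Prod.fst h
    have hsnd := congrArg Prod.snd h
    simp only [Prod.fst_mul, Prod.pow_fst, hT1, one_pow, one_mul] at hfst
    have hmod : i % n = j % n := by
      refine hw.1 _ (Nat.mod_lt _ hn0) _ (Nat.mod_lt _ hn0) ?_
      rw [h1, h1, hfst]
    simp only [Prod.snd_mul, Prod.pow_snd, hmod] at hsnd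
    have h3 := mul_right_cancel hsnd
    rw [pow_inj_mod, hordT, Nat.mod_eq_of_lt (Nat.div_lt_of_lt_mul (by rwa [Nat.mul_comm])),
      Nat.mod_eq_of_lt (Nat.div_lt_of_lt_mul (by rwa [Nat.mul_comm]))] at h3
    rw [← Nat.div_add_mod i n, ← Nat.div_add_mod j n, h3, hmod]
  · intro k hk
    have key : T ^ ((k + 1) / n) * wordProd γ w ((k + 1) % n)
        = T ^ (k / n) * wordProd γ w (k % n) * letterVal γ (w (k % n)) := by
      by_cases hr : k % n + 1 < n
      · have hmod : (k + 1) % n = k % n + 1 := by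
          rw [Nat.add_mod, Nat.mod_eq_of_lt (show 1 < n by omega), Nat.mod_eq_of_lt hr]
        have hd : (k + 1) / n = k / n := by
          rw [Nat.succ_div, if_neg]; rfl
          intro hdvd
          have : (k + 1) % n = 0 := Nat.mod_eq_zero_of_dvd hdvd
          omega
        rw [hd, hmod, wordProd, mul_assoc]
      · have hr' : k % n + 1 = n := by have := Nat.mod_lt k hn0; omega
        have hk' : k + 1 = n * (k / n + 1) := by
          have := Nat.div_add_mod k n
          rw [Nat.mul_succ]; omega
        rw [mul_assoc, ← wordProd_succ, hr', ← hT, hk', Nat.mul_div_cancel_left _ hn0,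
          Nat.mul_mod_right, wordProd, mul_one, pow_succ]
    simp only [key]
    exact letterVal_step S γ hγ _ _
  · have hd : (p * n - 1) / n = p - 1 := by
      rw [hlast, Nat.mul_add_div hn0, Nat.div_eq_of_lt (by omega), add_zero]
    have hmod : (p * n - 1) % n = n - 1 := by
      rw [hlast, Nat.mul_add_mod, Nat.mod_eq_of_lt (by omega)]
    have hone : T ^ (p - 1) * T = 1 := by
      rw [← pow_succ, show p - 1 + 1 = p by have := hp.pos; omega]
      refine Prod.ext ?_ ?_
      · simp [hT1]
      · rw [Prod.pow_snd, ← hordT, pow_orderOf_eq_one]; rfl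
    have hT' : T = wordProd γ w (n - 1) * letterVal γ (w (n - 1)) := by
      rw [← wordProd_succ, show n - 1 + 1 = n by omega]
    simp only [hd, hmod, Nat.zero_div, Nat.zero_mod, pow_zero, one_mul, wordProd]
    have hone' : 1 = T ^ (p - 1) * wordProd γ w (n - 1) * letterVal γ (w (n - 1)) := by
      rw [mul_assoc, ← hT', hone]
    rw [hone']
    exact letterVal_step S γ hγ _ _

theorem orderOf_eq_of_card_prime {Z : Type*} [CommGroup Z] [Fintype Z] {p : ℕ}
    (hp : p.Prime) (hZ : Fintype.card Z = p) {z : Z} (hz : z ≠ 1) : orderOf z = p := by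
  rcases (Nat.dvd_prime hp).1 (hZ ▸ orderOf_dvd_card : orderOf z ∣ p) with h | h
  · exact absurd (orderOf_eq_one_iff.1 h) hz
  · exact h

/-- If `S` contains a nontrivial element of the central factor, then a cyclic word in the other
factor gives a hamiltonian cycle. -/
theorem SimpleGraph.mulCayley_hamiltonian_of_central {H Z : Type*} [Group H] [CommGroup Z]
    [Fintype H] [Fintype Z] [DecidableEq H] [DecidableEq Z] (p : ℕ) [Fact p.Prime] (hp2 : p ≠ 2)
    (hZ : Fintype.card Z = p) (hH : 3 ≤ Fintype.card H) (heven : Even (Fintype.card H))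
    (S : Set (H × Z)) (c : H × Z) (hc : c ∈ S) (hc1 : c.1 = 1) (hc2 : c.2 ≠ 1)
    (γ : ℕ → H × Z) (hγ : ∀ i, γ i ∈ S) (w : ℕ → ℕ)
    (hw : IsCyclicWord (Fintype.card H) (fun i => (γ i).1) w) :
    ∃ (v : H × Z) (C : (SimpleGraph.mulCayley S).Walk v v), C.IsHamiltonianCycle := by
  by_cases hne : wordProd (fun i => (γ i).2) w (Fintype.card H) = 1
  swap
  · exact mulCayley_hamiltonian_of_wordProd_ne_one p hZ hH S γ hγ w hw hne
  have hp : p.Prime := Fact.out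
  have h1 : ∀ i, wordProd (fun i => (γ i).1) w i = (wordProd γ w i).1 :=
    map_wordProd (MonoidHom.fst H Z) γ w
  have h2 : ∀ i, wordProd (fun i => (γ i).2) w i = (wordProd γ w i).2 :=
    map_wordProd (MonoidHom.snd H Z) γ w
  have hcen : ∀ (x : H × Z) (k : ℤ), x * c ^ k = c ^ k * x := by
    intro x k
    refine Prod.ext ?_ ?_
    · simp [hc1]
    · simp [mul_comm]
  have hordc : orderOf c = p := by
    rw [Prod.orderOf, hc1, orderOf_one, orderOf_eq_of_card_prime hp hZ hc2, Nat.lcm_one_left]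
  have hpow1 : ∀ k : ℤ, (c ^ k).1 = 1 := by intro k; simp [hc1]
  -- The coset representatives follow `w`. The direction along `⟨c⟩` alternates, so the
  -- displacements by `c⁻¹` and `c` cancel in pairs, and the walk closes because the number of
  -- cosets is even.
  refine mulCayley_hamiltonian_of_cosets S c hc p (Fintype.card H)
    (by have := hp.two_le; omega) (by omega) hordc (by rw [Fintype.card_prod, hZ, Nat.mul_comm])
    (fun j => letterVal γ (w j)) (fun j => wordProd γ w j * c ^ (-((j % 2 : ℕ) : ℤ)))
    (fun j => 1 - 2 * ((j % 2 : ℕ) : ℤ)) ?_ (fun j _ => letterVal_mem S γ hγ (w j)) ?_ ?_ ?_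
  · intro j
    rcases Nat.mod_two_eq_zero_or_one j with h | h <;> simp [h]
  · intro j _
    simp only [wordProd_succ]
    rw [mul_assoc (wordProd γ w j) (c ^ _), ← hcen (letterVal γ (w j)), mul_assoc, mul_assoc,
      mul_assoc, ← zpow_add]
    congr 3
    omega
  · have hone : wordProd γ w (Fintype.card H) = 1 := by
      refine Prod.ext ?_ ?_
      · rw [← h1]; exact hw.2
      · rw [← h2]; exact hne
    simp only [hone, Nat.even_iff.1 heven]
    simp [wordProd]
  · intro i hi j hj hij
    obtain ⟨k, hk⟩ := hij
    have hk1 := congrArg Prod.fst hk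
    simp only [Prod.fst_mul, Prod.fst_inv, hpow1, mul_one] at hk1
    have e : (wordProd γ w i).1 * (letterVal γ (w i)).1
        = (wordProd γ w j).1 * (letterVal γ (w j)).1 := by
      rw [← mul_one ((wordProd γ w i).1 * _), hk1, mul_inv_cancel_left]
    rw [← Prod.fst_mul, ← Prod.fst_mul, ← wordProd_succ, ← wordProd_succ, ← h1, ← h1] at e
    -- The entry points are the prefixes of length `1, …, n`, whereas injectivity is known for `0,
    -- …, n - 1`; the prefix of length `n` is traded for the empty one.
    by_cases hi' : i + 1 < Fintype.card H <;> by_cases hj' : j + 1 < Fintype.card H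
    · have := hw.1 _ hi' _ hj' e; omega
    · rw [show j + 1 = Fintype.card H by omega, hw.2] at e
      have := hw.1 _ hi' 0 (by omega) e; omega
    · rw [show i + 1 = Fintype.card H by omega, hw.2] at e
      have := hw.1 0 (by omega) _ hj' e; omega
    · omega

/-- If `g 0` has order three and the image of the cyclic word `w` has the form
`∏ g 1 * (g 0) ^ (± 2)` with signs adding up to `0`, then the central factor can be absorbed in
the cosets of `⟨γ 0⟩`. -/
theorem SimpleGraph.mulCayley_hamiltonian_of_blocks {H Z : Type*} [Group H] [CommGroup Z]
    [Fintype H] [Fintype Z] [DecidableEq H] [DecidableEq Z] (p : ℕ) [Fact p.Prime] (hp3 : p ≠ 3)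
    (hZ : Fintype.card Z = p) (m : ℕ) (hm : 0 < m) (hH : Fintype.card H = 3 * m)
    (S : Set (H × Z)) (γ : ℕ → H × Z) (hγ : ∀ i, γ i ∈ S) (w : ℕ → ℕ)
    (hw : IsCyclicWord (3 * m) (fun i => (γ i).1) w)
    (hord : orderOf (γ 0).1 = 3) (hγ0 : (γ 0).2 ≠ 1) (hγ1 : (γ 1).2 = 1)
    (ε : ℕ → ℤ) (hε : ∀ j, ε j = 1 ∨ ε j = -1) (hw2 : ∀ j < m, w (3 * j) = 2)
    (hw0 : ∀ j < m, w (3 * j + 1) = if ε j = 1 then 0 else 1)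
    (hw1 : ∀ j < m, w (3 * j + 2) = if ε j = 1 then 0 else 1)
    (hsum : ∑ j ∈ Finset.range m, ε j = 0) :
    ∃ (v : H × Z) (C : (SimpleGraph.mulCayley S).Walk v v), C.IsHamiltonianCycle := by
  have hp : p.Prime := Fact.out
  have hordb : orderOf (γ 0) = 3 * p := by
    rw [Prod.orderOf, hord, orderOf_eq_of_card_prime hp hZ hγ0]
    exact Nat.Coprime.lcm_eq_mul ((Nat.coprime_primes Nat.prime_three hp).2 (Ne.symm hp3))
  set b := γ 0 with hb
  set g : ℕ → H := fun i => (γ i).1 with hg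
  have hg3 : b.1 ^ 3 = 1 := by rw [← hord, pow_orderOf_eq_one]
  let Q : ℕ → H × Z := fun j => Nat.rec 1 (fun j q => q * γ 1 * b ^ (-ε j)) j
  have hQs : ∀ j, Q (j + 1) = Q j * γ 1 * b ^ (-ε j) := fun _ => rfl
  have hl : ∀ j, letterVal g (if ε j = 1 then 0 else 1) = b.1 ^ ε j := by
    intro j
    rcases hε j with h | h <;> simp [h, letterVal, hg, hb]
  have hP : ∀ j < m, wordProd g w (3 * j + 1) = wordProd g w (3 * j) * g 1 := by
    intro j hj
    rw [wordProd_succ, hw2 j hj]; rfl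
  have hP1 : ∀ j < m, wordProd g w (3 * j + 2) = wordProd g w (3 * j) * g 1 * b.1 ^ ε j := by
    intro j hj
    rw [wordProd_succ, hw0 j hj, hl, hP j hj]
  have hP2 : ∀ j < m, wordProd g w (3 * j + 3)
      = wordProd g w (3 * j) * g 1 * b.1 ^ (2 * ε j) := by
    intro j hj
    rw [wordProd_succ, hw1 j hj, hl, hP1 j hj, two_mul, zpow_add]
    simp only [mul_assoc]
  -- In `H` the exit displacement `b ^ (-ε j)` equals `b ^ (2 * ε j)`, since the order is three.
  -- Hence the long traversal of a coset in the product ends above the same vertex as a block of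
  -- three letters of `w`.
  have hQ1 : ∀ j ≤ m, (Q j).1 = wordProd g w (3 * j) := by
    intro j
    induction j with
    | zero => intro _; rfl
    | succ j ih =>
      intro hj
      rw [hQs, show 3 * (j + 1) = 3 * j + 3 by ring, hP2 j (by omega), ← ih (by omega)]
      have : b.1 ^ (2 * ε j) = b.1 ^ (-ε j) := by
        have h3 : b.1 ^ (3 : ℤ) = 1 := by exact_mod_cast hg3
        rw [show 2 * ε j = 3 * ε j + (-ε j) by ring, zpow_add, zpow_mul, h3, one_zpow, one_mul]
      rw [this]; rfl
  have hQ2 : ∀ j, (Q j).2 = b.2 ^ (-∑ k ∈ Finset.range j, ε k) := by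
    intro j
    induction j with
    | zero => simp [Q]
    | succ j ih =>
      rw [hQs, Prod.snd_mul, Prod.snd_mul, ih, hγ1, mul_one, Finset.sum_range_succ, neg_add,
        zpow_add]
      rfl
  refine mulCayley_hamiltonian_of_cosets S b (hγ 0) (3 * p) m
    (by have := hp.two_le; omega) hm hordb (by rw [Fintype.card_prod, hZ, hH]; ring)
    (fun _ => γ 1) Q ε hε (fun _ _ => Or.inl (hγ 1)) (fun j _ => hQs j) ?_ ?_
  · refine Prod.ext ?_ ?_
    · rw [hQ1 m le_rfl, hw.2]; rfl
    · rw [hQ2, hsum]; simp [Q]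
  · intro i hi j hj hij
    obtain ⟨k, hk⟩ := hij
    have hk1 := congrArg Prod.fst hk
    simp only [Prod.fst_mul, Prod.fst_inv, Prod.pow_fst] at hk1
    rw [hQ1 i hi.le, hQ1 j hj.le, eq_inv_mul_iff_mul_eq] at hk1
    change wordProd g w (3 * i) * g 1 * b.1 ^ k = wordProd g w (3 * j) * g 1 at hk1
    rw [← hP j hj] at hk1
    -- The three vertices reached in block `i` form a full left coset of the group generated by the
    -- first component of `b`, so an entry point lying in that coset is one of them.
    obtain ⟨r, hr, e⟩ : ∃ r < 3, wordProd g w (3 * i + 1 + r) = wordProd g w (3 * j + 1) := by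
      -- The exponent is normalised to `ε i * s` with `0 ≤ s < 3`, the form in which block `i` lists
      -- its coset.
      have hred : b.1 ^ k = b.1 ^ (ε i * ((ε i * k) % 3)) := by
        rw [zpow_eq_zpow_iff_modEq, hord]
        have hm' : (ε i * k) % 3 ≡ ε i * k [ZMOD 3] := Int.mod_modEq _ _
        have := hm'.mul_left (ε i)
        rw [← mul_assoc] at this
        have h1 : ε i * ε i = 1 := by rcases hε i with h | h <;> simp [h]
        rw [h1, one_mul] at this
        exact this.symm
      have h0 := Int.emod_nonneg (ε i * k) (show (3 : ℤ) ≠ 0 by norm_num)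
      have h3 := Int.emod_lt_of_pos (ε i * k) (show (0 : ℤ) < 3 by norm_num)
      rw [← hk1, hred]
      generalize (ε i * k) % 3 = s at *
      interval_cases s
      · exact ⟨0, by norm_num, by simp [hP i hi]⟩
      · exact ⟨1, by norm_num, by rw [show 3 * i + 1 + 1 = 3 * i + 2 by ring, hP1 i hi, mul_one]⟩
      · exact ⟨2, by norm_num, by
          rw [show 3 * i + 1 + 2 = 3 * i + 3 by ring, hP2 i hi, mul_comm (2 : ℤ)]⟩
    by_cases hlt : 3 * i + 1 + r < 3 * m
    · have := hw.1 _ hlt _ (by omega) e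
      omega
    · rw [show 3 * i + 1 + r = 3 * m by omega, hw.2] at e
      have := hw.1 0 (by omega) (3 * j + 1) (by omega) e
      omega

/-! ### Permutations of five letters coded by natural numbers

The functions below are evaluated by the kernel; they are therefore written with the operations of
`ℕ` that it evaluates directly. -/

/-- The digit of `c` in base `8` at the place `i`. -/
def octDigit (c i : ℕ) : ℕ := Nat.mod (Nat.shiftRight c (Nat.mul (nat_lit 3) i)) (nat_lit 8)

/-- The number with the octal digits `a, b, c, d, e`, beginning with the least one. -/
def ofOctDigits (a b c d e : ℕ) : ℕ :=
  Nat.add a (Nat.mul (nat_lit 8) (Nat.add b (Nat.mul (nat_lit 8) (Nat.add c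
    (Nat.mul (nat_lit 8) (Nat.add d (Nat.mul (nat_lit 8) e)))))))

/-- The code of `g` has the octal digits `g 0, …, g 4`. -/
def permCode (g : Perm (Fin 5)) : ℕ := ofOctDigits (g 0) (g 1) (g 2) (g 3) (g 4)

def codeMul (c d : ℕ) : ℕ :=
  ofOctDigits (octDigit c (octDigit d (nat_lit 0))) (octDigit c (octDigit d (nat_lit 1)))
    (octDigit c (octDigit d (nat_lit 2))) (octDigit c (octDigit d (nat_lit 3)))
    (octDigit c (octDigit d (nat_lit 4)))

/-- The code of the inverse is the sum of `i * 8 ^ (g i)`; the term `i = 0` vanishes and is omitted.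
-/
def codeInv (c : ℕ) : ℕ :=
  Nat.add (Nat.shiftLeft 1 (Nat.mul 3 (octDigit c 1)))
    (Nat.add (Nat.shiftLeft 2 (Nat.mul 3 (octDigit c 2)))
      (Nat.add (Nat.shiftLeft 3 (Nat.mul 3 (octDigit c 3)))
        (Nat.shiftLeft 4 (Nat.mul 3 (octDigit c 4)))))

/-- `f n`, arranged so that `n` is evaluated before it is passed to `f`. -/
def strictApply {α : Type} (n : ℕ) (f : ℕ → α) : α :=
  Nat.casesOn n (f (nat_lit 0)) fun k => f (Nat.succ k)

/-- Prepends a digit in base `2 ^ 15`. -/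
def consDigit (a r : ℕ) : ℕ := Nat.add a (Nat.mul (nat_lit 32768) r)

/-- The digit of `T` in base `2 ^ 15` at the place `l`. -/
def tableDigit (T l : ℕ) : ℕ := Nat.mod (Nat.shiftRight T (Nat.mul (nat_lit 15) l)) (nat_lit 32768)

/-- The codes of the values of the letters `0, …, 7`. -/
def letterTable (a b c : ℕ) : ℕ :=
  strictApply (codeInv c) fun c' =>
    consDigit a <| consDigit (codeInv a) <| consDigit b <| consDigit (codeInv b) <|
      -- The letters 6 and 7 also denote the inverse of the third generator, so that every octal
      -- digit has an entry; the last entry is the leading digit.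
      consDigit c <| consDigit c' <| consDigit c' c'

/-- Follows `n` letters of the word `w` from the vertex `x`, where `vis` is the bit set of the
visited vertices, each represented by the last three digits of its code. -/
def followWord (T n : ℕ) : ℕ → ℕ → ℕ → Bool :=
  -- The number 18056 is `0o43210`, the code of the identity.
  Nat.rec (fun _ x _ => Nat.beq x (nat_lit 18056))
    (fun _ ih w x vis =>
      Bool.rec
        (strictApply (codeMul x (tableDigit T (Nat.mod w (nat_lit 8)))) fun y =>
          strictApply (Nat.lor vis (Nat.shiftLeft (nat_lit 1) (Nat.mod x (nat_lit 512))))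
            fun v =>
            strictApply (Nat.shiftRight w (nat_lit 3)) fun w' => ih w' y v)
        false (Nat.beq (Nat.mod (Nat.shiftRight vis (Nat.mod x (nat_lit 512))) (nat_lit 2))
          (nat_lit 1))) n

/-- Decides whether `w` is a cyclic word of length `60`, given the table of its letters. -/
def tableCyclic (T w : ℕ) : Bool := followWord T 60 w 0o43210 0

/-- The letters of a word that is given by a number in base `8`. -/
def octLetters (w : ℕ) (i : ℕ) : ℕ := w / 8 ^ i % 8

/-! ### Correctness of the coded arithmetic -/

theorem octDigit_eq (c i : ℕ) : octDigit c i = c / 8 ^ i % 8 := by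
  change (c >>> (3 * i)) % 8 = _
  rw [Nat.shiftRight_eq_div_pow, pow_mul]
  norm_num

theorem ofOctDigits_eq (a b c d e : ℕ) :
    ofOctDigits a b c d e = a + 8 * (b + 8 * (c + 8 * (d + 8 * e))) := rfl

theorem octDigit_permCode (g : Perm (Fin 5)) (i : Fin 5) : octDigit (permCode g) i = g i := by
  rw [octDigit_eq, permCode, ofOctDigits_eq]
  have := (g 0).isLt; have := (g 1).isLt; have := (g 2).isLt; have := (g 3).isLt
  have := (g 4).isLt
  fin_cases i <;> simp <;> omega

theorem permCode_injective : Function.Injective permCode := by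
  intro g h e
  ext i
  rw [← octDigit_permCode, e, octDigit_permCode]

theorem permCode_one : permCode 1 = 0o43210 := by decide

theorem permCode_lt (g : Perm (Fin 5)) : permCode g < 32768 := by
  rw [permCode, ofOctDigits_eq]
  have := (g 0).isLt; have := (g 1).isLt; have := (g 2).isLt; have := (g 3).isLt
  have := (g 4).isLt
  omega

theorem permCode_mul (g h : Perm (Fin 5)) : permCode (g * h) = codeMul (permCode g) (permCode h) := by
  have h0 : octDigit (permCode h) (nat_lit 0) = h 0 := octDigit_permCode h 0
  have h1 : octDigit (permCode h) (nat_lit 1) = h 1 := octDigit_permCode h 1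
  have h2 : octDigit (permCode h) (nat_lit 2) = h 2 := octDigit_permCode h 2
  have h3 : octDigit (permCode h) (nat_lit 3) = h 3 := octDigit_permCode h 3
  have h4 : octDigit (permCode h) (nat_lit 4) = h 4 := octDigit_permCode h 4
  rw [codeMul, h0, h1, h2, h3, h4]
  simp only [octDigit_permCode]
  rfl

theorem permCode_inv (g : Perm (Fin 5)) : permCode g⁻¹ = codeInv (permCode g) := by
  have key : ∀ h : Perm (Fin 5), permCode h = ∑ i : Fin 5, (h i : ℕ) * 8 ^ (i : ℕ) := by
    intro h
    rw [permCode, ofOctDigits_eq, Fin.sum_univ_five]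
    simp; ring
  have h1 := octDigit_permCode g 1
  have h2 := octDigit_permCode g 2
  have h3 := octDigit_permCode g 3
  have h4 := octDigit_permCode g 4
  simp only [Fin.val_one, Fin.val_two, show ((3 : Fin 5) : ℕ) = 3 from rfl,
    show ((4 : Fin 5) : ℕ) = 4 from rfl] at h1 h2 h3 h4
  rw [key, ← Equiv.sum_comp g, Fin.sum_univ_five, codeInv, h1, h2, h3, h4]
  change _ = 1 <<< (3 * _) + (2 <<< (3 * _) + (3 <<< (3 * _) + 4 <<< (3 * _)))
  simp [Nat.shiftLeft_eq, pow_mul]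
  ring

theorem strictApply_eq {α : Type} (n : ℕ) (f : ℕ → α) : strictApply n f = f n := by
  cases n <;> rfl

theorem tableDigit_zero {a : ℕ} (r : ℕ) (ha : a < 32768) : tableDigit (consDigit a r) 0 = a := by
  change ((a + 32768 * r) >>> (15 * 0)) % 32768 = a
  rw [Nat.shiftRight_eq_div_pow]
  simp [Nat.mod_eq_of_lt ha]

theorem tableDigit_succ {a : ℕ} (r l : ℕ) (ha : a < 32768) :
    tableDigit (consDigit a r) (l + 1) = tableDigit r l := by
  change ((a + 32768 * r) >>> (15 * (l + 1))) % 32768 = (r >>> (15 * l)) % 32768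
  rw [Nat.shiftRight_eq_div_pow, Nat.shiftRight_eq_div_pow, show 15 * (l + 1) = 15 + 15 * l by ring,
    pow_add, ← Nat.div_div_eq_div_mul, show 2 ^ 15 = 32768 by norm_num,
    Nat.add_mul_div_left _ _ (by norm_num), Nat.div_eq_of_lt ha, zero_add]

theorem tableDigit_letterTable (g : ℕ → Perm (Fin 5)) (l : ℕ) (hl : l < 8) :
    tableDigit (letterTable (permCode (g 0)) (permCode (g 1)) (permCode (g 2))) l
      = permCode (letterVal g l) := by
  rw [letterTable, strictApply_eq]
  simp only [← permCode_inv]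
  have h := permCode_lt
  have hself : ∀ a < 32768, tableDigit a 0 = a := by
    intro a ha
    change (a >>> (15 * 0)) % 32768 = a
    simp [Nat.mod_eq_of_lt ha]
  interval_cases l
  · rw [tableDigit_zero _ (h _)]; rfl
  · rw [tableDigit_succ _ _ (h _), tableDigit_zero _ (h _)]; rfl
  · rw [tableDigit_succ _ _ (h _), tableDigit_succ _ _ (h _), tableDigit_zero _ (h _)]; rfl
  · rw [tableDigit_succ _ _ (h _), tableDigit_succ _ _ (h _), tableDigit_succ _ _ (h _),
      tableDigit_zero _ (h _)]; rfl
  · rw [tableDigit_succ _ _ (h _), tableDigit_succ _ _ (h _), tableDigit_succ _ _ (h _),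
      tableDigit_succ _ _ (h _), tableDigit_zero _ (h _)]; rfl
  · rw [tableDigit_succ _ _ (h _), tableDigit_succ _ _ (h _), tableDigit_succ _ _ (h _),
      tableDigit_succ _ _ (h _), tableDigit_succ _ _ (h _), tableDigit_zero _ (h _)]; rfl
  · rw [tableDigit_succ _ _ (h _), tableDigit_succ _ _ (h _), tableDigit_succ _ _ (h _),
      tableDigit_succ _ _ (h _), tableDigit_succ _ _ (h _), tableDigit_succ _ _ (h _),
      tableDigit_zero _ (h _)]; rfl
  · rw [tableDigit_succ _ _ (h _), tableDigit_succ _ _ (h _), tableDigit_succ _ _ (h _),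
      tableDigit_succ _ _ (h _), tableDigit_succ _ _ (h _), tableDigit_succ _ _ (h _),
      tableDigit_succ _ _ (h _), hself _ (h _)]; rfl

/-- Splits off the first letter rather than the last, since `followWord` consumes the word from its
lowest octal digit. -/
theorem wordProd_succ' {H : Type*} [Group H] (g : ℕ → H) (w : ℕ → ℕ) (n : ℕ) :
    wordProd g w (n + 1) = letterVal g (w 0) * wordProd g (fun i => w (i + 1)) n := by
  induction n with
  | zero => simp [wordProd]
  | succ n ih => rw [wordProd_succ, ih, wordProd_succ, mul_assoc]

theorem octLetters_shiftRight (w i : ℕ) : octLetters (Nat.shiftRight w 3) i = octLetters w (i + 1) := by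
  change (w >>> 3) / 8 ^ i % 8 = w / 8 ^ (i + 1) % 8
  rw [Nat.shiftRight_eq_div_pow, Nat.div_div_eq_div_mul, pow_succ']
  norm_num [pow_succ']

theorem followWord_succ (T n w x vis : ℕ) :
    followWord T (n + 1) w x vis =
      (!vis.testBit (x % 512) && followWord T n (Nat.shiftRight w 3)
        (codeMul x (tableDigit T (w % 8))) (vis ||| 1 <<< (x % 512))) := by
  have hb : Nat.beq (Nat.mod (Nat.shiftRight vis (Nat.mod x 512)) 2) 1 = vis.testBit (x % 512) := by
    rw [Bool.eq_iff_iff, Nat.beq_eq, Nat.testBit_eq_decide_div_mod_eq, ← Nat.shiftRight_eq_div_pow,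
      decide_eq_true_eq]
    rfl
  have : followWord T (n + 1) w x vis = Bool.rec
        (strictApply (codeMul x (tableDigit T (Nat.mod w 8))) fun y =>
          strictApply (Nat.lor vis (Nat.shiftLeft 1 (Nat.mod x 512))) fun v =>
            strictApply (Nat.shiftRight w 3) fun w' => followWord T n w' y v)
        false (Nat.beq (Nat.mod (Nat.shiftRight vis (Nat.mod x 512)) 2) 1) := rfl
  rw [this, hb]
  simp only [strictApply_eq]
  cases vis.testBit (x % 512) <;> rfl

/-- The invariant is that the remaining walk avoids all residues marked in `vis`. Distinct residues
modulo 512 imply distinct vertices, and only this direction is needed; a coincidence of residues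
could merely make the test fail. -/
theorem followWord_sound (g : ℕ → Perm (Fin 5)) (T : ℕ)
    (hT : ∀ l < 8, tableDigit T l = permCode (letterVal g l)) (n : ℕ) :
    ∀ (w : ℕ) (u : Perm (Fin 5)) (vis : ℕ), followWord T n w (permCode u) vis = true →
      (∀ i < n, vis.testBit (permCode (u * wordProd g (octLetters w) i) % 512) = false) ∧
      (∀ i < n, ∀ j < n, wordProd g (octLetters w) i = wordProd g (octLetters w) j → i = j) ∧
      u * wordProd g (octLetters w) n = 1 := by
  induction n with
  | zero =>
    intro w u vis h
    refine ⟨by simp, by simp, ?_⟩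
    have h' : permCode u = 0o43210 := Nat.eq_of_beq_eq_true h
    rw [← permCode_one] at h'
    simp [wordProd, permCode_injective h']
  | succ n ih =>
    intro w u vis h
    rw [followWord_succ, Bool.and_eq_true, Bool.not_eq_true'] at h
    obtain ⟨hvis, h⟩ := h
    rw [hT _ (Nat.mod_lt _ (by norm_num)), ← permCode_mul] at h
    obtain ⟨h1, h2, h3⟩ := ih _ _ _ h
    have hw : ∀ i, wordProd g (octLetters w) (i + 1)
        = letterVal g (w % 8) * wordProd g (octLetters (Nat.shiftRight w 3)) i := by
      intro i
      rw [wordProd_succ']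
      congr 1
      · simp [octLetters]
      · congr 1
        ext k
        exact (octLetters_shiftRight w k).symm
    have hne : ∀ i < n, wordProd g (octLetters w) (i + 1) ≠ 1 := by
      intro i hi e
      have := h1 i hi
      -- A trivial prefix would lead back to `u`, whose bit has just been set.
      rw [mul_assoc, ← hw, e, mul_one, Nat.testBit_or, Bool.or_eq_false_iff] at this
      simp [Nat.testBit_shiftLeft] at this
    refine ⟨?_, ?_, ?_⟩
    · intro i hi
      cases i with
      | zero => simpa [wordProd] using hvis
      | succ i =>
        have := h1 i (by omega)
        rw [mul_assoc, ← hw, Nat.testBit_or, Bool.or_eq_false_iff] at this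
        exact this.1
    · intro i hi j hj e
      cases i with
      | zero =>
        cases j with
        | zero => rfl
        | succ j => exact absurd e.symm (hne j (by omega))
      | succ i =>
        cases j with
        | zero => exact absurd e (hne i (by omega))
        | succ j =>
          rw [hw, hw] at e
          rw [h2 i (by omega) j (by omega) (mul_left_cancel e)]
    · rw [hw, ← mul_assoc]; exact h3

theorem isCyclicWord_of_tableCyclic (g : ℕ → alternatingGroup (Fin 5)) (w : ℕ)
    (h : tableCyclic (letterTable (permCode (g 0)) (permCode (g 1)) (permCode (g 2))) w = true) :
    IsCyclicWord 60 g (octLetters w) := by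
  have hm : ∀ i, wordProd (fun i => (g i : Perm (Fin 5))) (octLetters w) i
      = ((wordProd g (octLetters w) i : alternatingGroup (Fin 5)) : Perm (Fin 5)) :=
    map_wordProd (alternatingGroup (Fin 5)).subtype g (octLetters w)
  rw [tableCyclic, ← permCode_one] at h
  obtain ⟨-, h2, h3⟩ := followWord_sound (fun i => (g i : Perm (Fin 5))) _
    (tableDigit_letterTable (fun i => (g i : Perm (Fin 5)))) 60 w 1 0 h
  refine ⟨fun i hi j hj e => h2 i hi j hj (by rw [hm, hm, e]), ?_⟩
  rw [one_mul, hm] at h3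
  exact_mod_cast h3

/-! ### Lists of even permutations and of words of length sixty -/

/-- The codes of the even permutations. -/
def evenCodes : List ℕ := [
  0o01234, 0o01342, 0o01423, 0o02143, 0o02314, 0o02431, 0o03124, 0o03241, 0o03412, 0o04132,
  0o04213, 0o04321, 0o10243, 0o10324, 0o10432, 0o12034, 0o12340, 0o12403, 0o13042, 0o13204,
  0o13420, 0o14023, 0o14230, 0o14302, 0o20134, 0o20341, 0o20413, 0o21043, 0o21304, 0o21430,
  0o23014, 0o23140, 0o23401, 0o24031, 0o24103, 0o24310, 0o30142, 0o30214, 0o30421, 0o31024,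
  0o31240, 0o31402, 0o32041, 0o32104, 0o32410, 0o34012, 0o34120, 0o34201, 0o40123, 0o40231,
  0o40312, 0o41032, 0o41203, 0o41320, 0o42013, 0o42130, 0o42301, 0o43021, 0o43102, 0o43210]

/-- Words with first letter `0` in an involution and one further generator. -/
def flipWords : List ℕ := [
  0o220330220330220330330330220220220330220330220330330330220220,
  0o333303033033330203030220330333303303333020303022033033033330,
  0o202222022022220330333302030333302222022033330333303302222030]

/-- Words in two generators, in which only the letters `0` and `1` do not cancel in number. -/
def netWords : List ℕ := [
  0o113002202203031121220033112200221130330033130022112200330033,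
  0o311312200331133021130213133112211203112020020022112112003330,
  0o222002202003311313002002131131131121221131130031131311203112,
  0o330221331330331221221130221220213312202203312211330331331220,
  0o133131220331122122120330033113313002122022022113121330220331,
  0o121112131113030331111311222031330000303112200212120211211311,
  0o300002203121120311200003000221111211311113031300002111130000,
  0o120311222212213121330212221133003312131131130020203121313303,
  0o030203022030031202200302220022221211213313030333031300200330]

/-- Pairs of words in two generators, with coefficients that make the numbers of the letters `2` and
`3` cancel. -/
def netPairs : List (ℤ × ℕ × ℤ × ℕ) := [
  (-5, 0o331311331222002222002020220311200331131211220020300311211200,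
    -7, 0o213331133033133002003003002213113311211211211211311220020311),
  (7, 0o211300203030033330030200221121311300200211330030200300211311,
    5, 0o222002113121122031333313030200222121122121311300200200211300),
  (1, 0o112112112121111211112112021212003111130031131311303111131311,
    1, 0o112112112121111211112112021213003111130031131311303111131311),
  (-1, 0o122033133002202120022020000220202122113313022113313033022122,
    -9, 0o002212000220202003112131133022111313311113313113022133022133),
  (1, 0o002111120021111211211112120212000030031111311311113130311113,
    1, 0o002111120021111211211112120213000030031111311311113130311113),
  (5, 0o031330220000330303031330000220331303300213112202202202202213,
    1, 0o133122033133033122021221111221212033112212033112212022021221)]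

/-- A word consisting of blocks `2 0 0` and `2 1 1`. -/
def blockWord : ℕ :=
  0o002112112112002112002112002002002112112112002112002112002002

/-- Words with first letter `0` in an involution and two further generators, with the orders of
some products. -/
def flipWordsTriple : List (ℕ × ℕ) := [
  (0o25332, 0o442442440552404402440552440442442550204404204024250550202440),
  (0o25332, 0o420425524425520420244255205040255205040255244255044205020440),
  (0o35332, 0o552055044052055040525520424405250440552440255025520552550440),
  (0o35332, 0o524420525505525525504044020550244244205044025504404420550550),
  (0o55222, 0o404020242020242040402420202420402042404042404040404240404240),
  (0o35222, 0o202040204240204020404020204240204020204240404240204040204240),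
  (0o35322, 0o204204024024040424240404202404204240240424240240242040242420),
  (0o35522, 0o404202402020420240404204040202040240240404204204020204040240),
  (0o35232, 0o244240204424402552504405525504240255250442550550442550552440),
  (0o25352, 0o525504050442024404204055052050402555504444202040252052440550),
  (0o35532, 0o244240525255044240202552042440244205020552525044055042025520),
  (0o25532, 0o552550442550442552040502442050402050402550552550442050402550),
  (0o35232, 0o525520442440550420442550440550442550202042055202420440404240),
  (0o55322, 0o420404040202040202042020404042040204202040404202040404204020),
  (0o35532, 0o244255244255255044055250244255255044244244050244044255255250),
  (0o25522, 0o202404202424202404242020402020204020202040242024202404202420),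
  (0o25552, 0o520405552505520405020405250555505520405040502050255240440550),
  (0o25352, 0o424240440250550202505204050204020555040240424050240420402440),
  (0o35532, 0o550255202425525504404424420424402550550420425504204424402550),
  (0o35532, 0o550442552550202550252440424052442424402405505524424405504420),
  (0o25322, 0o424240420202024202024242024202024202420240424240424240424240),
  (0o55522, 0o240420204040404020424042040240402020402042420402402404202020),
  (0o25532, 0o252442550552440442020244250550240440202524042505502440552040),
  (0o35522, 0o242402420420242024024020420204242042020420424020242042424020),
  (0o55322, 0o204024020202040204020204020202404020204042040202020204042040),
  (0o25552, 0o442025052404250525040240420504024042505504050204050204404240),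
  (0o22535, 0o255224422550552405025055024044340433550552040305505355334430),
  (0o22335, 0o424334420402030503442050205043440443302035530205343553020440),
  (0o32235, 0o344053403443333440255205224252202535205530342553440330344020),
  (0o32535, 0o430344024422225242252224402442404344024404424404333443424420),
  (0o52325, 0o224243333033334020304020302030430342022220420222202242022220),
  (0o32525, 0o334334204342033404020434204334333434243334030240404343430430),
  (0o32325, 0o402042434042424022404340422402424204224224340433303430404030),
  (0o32325, 0o402402043402403024220422430343433042403043402040304240203040),
  (0o32535, 0o204405343553044304424044335535535340442425525343443553034430),
  (0o22355, 0o442204020424203040204240425030405020405202403020503303402030),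
  (0o32535, 0o344255253525535534405034350553443355303504425224433535535530),
  (0o22535, 0o552552552204020440344342022442403040302505502044043552552550),
  (0o32335, 0o255350204424025334250255342243552052530344334403303504424420),
  (0o52325, 0o433422424224343424240204334243333434334202433434304042422040),
  (0o32235, 0o224404424435022552522505030533335522224353055244255024042550),
  (0o22325, 0o334340433330334240334030203040203042022030204303333040304020),
  (0o22355, 0o334335242024253435505533303443505343043050240430504240503050),
  (0o22255, 0o420250205030205020340443033050425340503050334240205020302030),
  (0o32335, 0o553442552442552225524250550442550552424405505520502552443440),
  (0o32535, 0o552443443442505255255224424303552440352443352244222240355350),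
  (0o22525, 0o424222420242222040203303402404302030420220330340304303302240),
  (0o52525, 0o222240203020304020302030430330203043303333034030203020433330),
  (0o22235, 0o553430553440243044225534205033533404403303553442442040502550),
  (0o32525, 0o243403040304020334333343340422043033402043342242043404042420),
  (0o52525, 0o433424303334243042240334042404030424033434024340220240434020),
  (0o22555, 0o533552404222202250440420402040503040205035055030205505353350),
  (0o52323, 0o422422022422022420220433022433420220422033420220433022430330),
  (0o32233, 0o422530344220225224335330225030240204334050433033534334403020),
  (0o32333, 0o505530205355335055030205522522055335055340534330553424422550),
  (0o52323, 0o433403020422433422033430343302242243342202240304224224043340),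
  (0o32323, 0o424334303422403020403020403340422422403043303342203342203340),
  (0o32533, 0o552552204043443522442442025203355253022422405225335225530330),
  (0o22353, 0o224424334302252252242052242204334022024224335522503025055220),
  (0o22553, 0o334334442022040302043033553022555220224020305033050204224330),
  (0o32533, 0o522433534244225535525533022422550302044224052035034255302250),
  (0o22533, 0o225533425524404425522040502250550304334334042250420224044330),
  (0o22523, 0o224030204034224220224224204033034020304303304030204020304330),
  (0o52523, 0o433433433033402030434033034330334303304220334220224224334220),
  (0o22553, 0o224442404224044242522022522522550533034033034020305240240440),
  (0o22253, 0o225342404243433033502202433505224033035020304030205030205330),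
  (0o52523, 0o334330334330334330224224020304334033034030204030204030204330),
  (0o53322, 0o204240204204040204242404040420202424202024202420242042402040),
  (0o33532, 0o552402502025520244244055055250440520505255055244242442550440),
  (0o33532, 0o255255055205255055250520440204405504204402440524024255020440),
  (0o53522, 0o420404024242040402404040424040204020404040402040204042404040),
  (0o33522, 0o424202024240202042024042042402042420402020402040204242024040),
  (0o33232, 0o242520442550202552502552502420442440552440552440525520442440),
  (0o23352, 0o244044405020405025040250550402504024042044042020504055052040),
  (0o23352, 0o520255055550520555505205040550520242550555505204404240440550),
  (0o33332, 0o252025055055025525044202552552525505525044204424404240440440),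
  (0o23332, 0o552552042550442055052440552502404402550442442505502440552550),
  (0o23522, 0o402424042024204024202024204024042040242020242040242024042420),
  (0o53522, 0o424024242424204040424040424240424204240404042424040404204240),
  (0o23552, 0o525555205244250204205040242042404402505205040520502040504250),
  (0o23552, 0o424404204050425052025020240444402440420405024444044442520440),
  (0o53222, 0o404042402040204024204040202040424040242020242020242042402420)]

/-- Words in three generators, in which only the letters `0` and `1` do not cancel in number, with
the orders of some products. -/
def netWordsTriple : List (ℕ × ℕ) := [
  (0o22323, 0o400251141300200511211341151300411300251211241300533112121300),
  (0o22233, 0o400330303122551151404300211430030311511521122112422003030200),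
  (0o32333, 0o431330033005114151133122021240020031141122002115533002203020),
  (0o22523, 0o422002031331513112040021131130051121131131143112002135140522),
  (0o32523, 0o433133531220212422133530033030411522003313302422533122022022),
  (0o22533, 0o142403003511224114140225005221335113121215114022133113343355),
  (0o22523, 0o411305004200200511311431302002503300303300411300522021212200),
  (0o32533, 0o431343355022134243312251221141124003420022151553300303020050),
  (0o32523, 0o420020313311511311311211422122022033500311211422003033003511),
  (0o32533, 0o415115224300220244330022021315500530503030411402213533421311),
  (0o22533, 0o134404414422151135211552050055255252551440440443531335534404),
  (0o32223, 0o402200351133034031350043122500221214115114250020304150043511),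
  (0o23323, 0o334133003021225133113411200302002511200311200400302002211511),
  (0o23333, 0o122114400405153530550255134404121441424134135531144253535522),
  (0o33233, 0o413433411313311522422133550220252122550521343134422133033022),
  (0o23523, 0o412003002211511213113300411200500220020300422031313300500311),
  (0o33523, 0o422002512242133052030042030035314311225003311435221140311530),
  (0o23533, 0o442055150524431135533440205514405335240552252213441311224433),
  (0o23523, 0o433133020220511240050311211411251405311211400213113311511200),
  (0o33533, 0o431214133135313311552120200411221120044352152240511213113311),
  (0o33523, 0o433151213124221250433120531211242531435204005142250043311533),
  (0o33533, 0o205043112131133044303142204035112020051124221151121311330055),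
  (0o23533, 0o220020443355315252414242252133550203121142052430343553303344),
  (0o33223, 0o420500302002211420033033533133022133433022133033522022122122),
  (0o23522, 0o240350040213502141153114002005003004211511300411205004300500),
  (0o23532, 0o155044115142004051150043004051551142004115113440055051442003),
  (0o33532, 0o250041150041311551151400255051551300511412443441550442411344),
  (0o23322, 0o425004035042035240050341151200314125300240514300500214115311),
  (0o33322, 0o114211352003412030251143052430052113402115031213420302130253),
  (0o23232, 0o250534200440443441552440055155355044055244044300405005255300),
  (0o23522, 0o425340520030402003020050030021130041120051130021134211500311),
  (0o33532, 0o411440040502511551153004005005002441550441553112551404044113),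
  (0o33522, 0o141125130400521311400512041530425003112415030425143511200435),
  (0o33232, 0o020043155120403521553511551511442440342530044211504040044355),
  (0o23532, 0o044152500505003005505052440414411443005505115142055300244344),
  (0o33522, 0o411211300211511311200411351141120031511214003005112400300500)]

/-! ### The exhaustive check -/

/-- Does the permutation with code `b` fix `i`? -/
def codeFixes (i b : ℕ) : Bool := Nat.beq (octDigit b i) i

/-- Does conjugation by the permutation with code `b` map the one with code `r` to itself or to its
inverse? -/
def codeInverts (r b : ℕ) : Bool :=
  strictApply (codeMul b r) fun c =>
    Nat.beq c (codeMul r b) || Nat.beq c (codeMul (codeInv r) b)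

/-- The order of the nontrivial even permutation with code `a`. -/
def codeOrder (a : ℕ) : ℕ :=
  strictApply (codeMul a a) fun b => cond (Nat.beq b 0o43210) 2 <|
    cond (Nat.beq (codeMul b a) 0o43210) 3 5

/-- The orders of some products. -/
def orderSignature (a b c : ℕ) : ℕ :=
  ofOctDigits (codeOrder b) (codeOrder c) (codeOrder (codeMul b c)) (codeOrder (codeMul a b))
    (codeOrder (codeMul a c))

/-- Is one of `words` a cyclic word for the permutations with codes `a, b, b`? -/
def anyCyclic (words : List ℕ) (a b : ℕ) : Bool :=
  strictApply (letterTable a b b) fun T => words.any fun w => tableCyclic T w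

/-- Does one of the pairs of `pairs` consist of cyclic words? -/
def anyCyclicPair (pairs : List (ℤ × ℕ × ℤ × ℕ)) (a b : ℕ) : Bool :=
  strictApply (letterTable a b b) fun T =>
    pairs.any fun q => tableCyclic T q.2.1 && tableCyclic T q.2.2.2

/-- Is one of the words of `words` that have the right signature a cyclic word for the permutations
with codes `a, b, c`? -/
def anyCyclicTriple (words : List (ℕ × ℕ)) (a b c : ℕ) : Bool :=
  strictApply (letterTable a b c) fun T => strictApply (orderSignature a b c) fun s =>
    words.any fun q => Nat.beq q.1 s && tableCyclic T q.2

/-- The two codes are the 5-cycle `(0 1 2 3 4)` and its square, one for each class of 5-cycles in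
A_5. The proper subgroups containing a 5-cycle lie in its dihedral normalizer, so only `b` outside
of it need a word. -/
theorem check_order_five :
    ([0o04321, 0o10432].all fun r => evenCodes.all fun b => codeInverts r b ||
      (anyCyclic netWords r b || anyCyclicPair netPairs r b)) = true := by
  decide +kernel

/-- Does the permutation with code `b` generate a proper subgroup together with `(0 1 2)`? -/
def properOrderThree (b : ℕ) : Bool := codeFixes 3 b || (codeFixes 4 b || codeInverts 0o43021 b)

/-- The maximal subgroups containing `(0 1 2)` are the stabilizers of 3 and of 4 and the normalizer
of `⟨(0 1 2)⟩`. The last alternative admits an involution `b` through `blockWord`, without a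
detecting word for the first generator. -/
theorem check_order_three_pair :
    (evenCodes.all fun b => properOrderThree b || (anyCyclic netWords 0o43021 b ||
      (anyCyclicPair netPairs 0o43021 b ||
      (Nat.beq (codeMul b b) 0o43210 && anyCyclic [blockWord] 0o43021 b)))) = true := by
  decide +kernel

/-- Covers generating sets in which no single element generates A_5 together with `(0 1 2)`: `d`
lies in a point stabilizer but not in the normalizer, and `b` moves the point. -/
theorem check_order_three_triple :
    ([3, 4].all fun i => evenCodes.all fun d => !codeFixes i d || (codeInverts 0o43021 d ||
      evenCodes.all fun b => codeFixes i b || (!properOrderThree b ||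
        anyCyclicTriple netWordsTriple 0o43021 d b))) = true := by
  decide +kernel

/-- Codes of two elements of order three and two of order five, which generate the cyclic subgroups
of odd order that are normalized by `(0 1) (2 3)`. -/
def invertedCodes : List ℕ := [0o03241, 0o24310, 0o30421, 0o24031]

/-- Does the permutation with code `b` generate a proper subgroup together with `(0 1) (2 3)`? -/
def properOrderTwo (b : ℕ) : Bool :=
  codeFixes 4 b || invertedCodes.any fun r => codeInverts r b

theorem check_order_two_pair :
    (evenCodes.all fun b => properOrderTwo b || anyCyclic flipWords 0o42301 b) = true := by
  decide +kernel

/-- Covers generating sets without a single partner for `(0 1) (2 3)`: `b` moves 4, hence normalizes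
one of the inverted subgroups, and `c` does not normalize it. -/
theorem check_order_two_triple :
    (invertedCodes.all fun r => evenCodes.all fun b => codeFixes 4 b || (!codeInverts r b ||
      evenCodes.all fun c => codeInverts r c || (!properOrderTwo c ||
        anyCyclicTriple flipWordsTriple 0o42301 b c))) = true := by
  decide +kernel

/-! ### Even permutations and their conjugacy classes -/

set_option maxRecDepth 10000 in
theorem permCode_mem_evenCodes : ∀ g : alternatingGroup (Fin 5), permCode g ∈ evenCodes := by
  decide +kernel

theorem card_alternatingGroup_five : Fintype.card (alternatingGroup (Fin 5)) = 60 := by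
  rw [card_alternatingGroup]; simp; decide

/-- By counting: the codes of the 60 elements are distinct and lie in a list of length 60, so they
exhaust it. -/
theorem exists_permCode_eq {c : ℕ} (hc : c ∈ evenCodes) :
    ∃ g : alternatingGroup (Fin 5), permCode g = c := by
  have hsub : (Finset.univ.image fun g : alternatingGroup (Fin 5) => permCode g) ⊆
      evenCodes.toFinset := by
    intro c hc
    obtain ⟨g, -, rfl⟩ := Finset.mem_image.1 hc
    exact List.mem_toFinset.2 (permCode_mem_evenCodes g)
  have hcard : evenCodes.toFinset.card ≤
      (Finset.univ.image fun g : alternatingGroup (Fin 5) => permCode g).card := by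
    rw [Finset.card_image_of_injective _ fun g h e => Subtype.ext (permCode_injective e),
      Finset.card_univ, card_alternatingGroup_five]
    exact evenCodes.toFinset_card_le
  have := (Finset.eq_of_subset_of_card_le hsub hcard).symm ▸ List.mem_toFinset.2 hc
  obtain ⟨g, -, hg⟩ := Finset.mem_image.1 this
  exact ⟨g, hg⟩

/-- The four codes represent the nontrivial conjugacy classes: `(0 1) (2 3)`, `(0 1 2)`, and the two
classes of 5-cycles. -/
theorem check_conj :
    (evenCodes.all fun s => Nat.beq s 0o43210 || evenCodes.any fun t =>
      [0o42301, 0o43021, 0o04321, 0o10432].any fun r => Nat.beq (codeMul t s) (codeMul r t)) =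
        true := by
  decide +kernel

theorem exists_conj_eq (s : alternatingGroup (Fin 5)) (hs : s ≠ 1) :
    ∃ t : alternatingGroup (Fin 5), permCode (t * s * t⁻¹ : alternatingGroup (Fin 5)) ∈
      [0o42301, 0o43021, 0o04321, 0o10432] := by
  have h := List.all_eq_true.1 check_conj _ (permCode_mem_evenCodes s)
  rw [Bool.or_eq_true] at h
  rcases h with h | h
  · have h1 := Nat.eq_of_beq_eq_true h
    rw [← permCode_one] at h1
    exact absurd (Subtype.ext (permCode_injective h1)) hs
  · obtain ⟨c, hc, h⟩ := List.any_eq_true.1 h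
    obtain ⟨t, rfl⟩ := exists_permCode_eq hc
    obtain ⟨r, hr, h⟩ := List.any_eq_true.1 h
    obtain ⟨r', rfl⟩ : ∃ r' : alternatingGroup (Fin 5), permCode r' = r := by
      refine exists_permCode_eq ?_
      clear h
      revert r; decide
    have h1 := Nat.eq_of_beq_eq_true h
    rw [← permCode_mul, ← permCode_mul] at h1
    have h2 : t * s = r' * t := Subtype.ext (permCode_injective h1)
    exact ⟨t, by rw [h2, mul_inv_cancel_right]; exact hr⟩

theorem check_exists_not_inverts :
    ((0o43021 :: 0o04321 :: 0o10432 :: invertedCodes).all fun r =>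
      evenCodes.contains r && evenCodes.any fun b => !codeInverts r b) = true := by
  decide +kernel

/-! ### Cyclic words with nontrivial product in the second factor -/

/-- For every choice of lifts of the generators `g`, whose components in `Z` are `z`, such that the
lift of `g i` is not in the first factor, some cyclic word has a nontrivial product in `Z`. -/
def Detects (Z : Type*) [CommGroup Z] {H : Type*} [Group H] (g : ℕ → H) (i : ℕ) : Prop :=
  ∀ z : ℕ → Z, z i ≠ 1 → ∃ w, IsCyclicWord 60 g w ∧ wordProd z w 60 ≠ 1

theorem Detects.map_equiv {Z : Type*} [CommGroup Z] {H K : Type*} [Group H] [Group K]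
    {g : ℕ → H} {i : ℕ} (h : Detects Z g i) (φ : H ≃* K) : Detects Z (fun j => φ (g j)) i :=
  fun z hz => (h z hz).imp fun _ hw => ⟨hw.1.map_equiv φ, hw.2⟩

/-- The exponent of every element of `Z` is prime to the primes below `30`. -/
def NoSmallTorsion (Z : Type*) [CommGroup Z] : Prop :=
  -- The constant is the product of the ten primes from 2 to 29.
  ∀ D : ℤ, D ∣ 6469693230 → ∀ z : Z, z ^ D = 1 → z = 1

theorem letterVal_two_mul {H : Type*} [Group H] (f : ℕ → H) {i : ℕ} (hi : i < 2) :
    letterVal f (2 * i) = f i ∧ letterVal f (2 * i + 1) = (f i)⁻¹ := by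
  interval_cases i <;> exact ⟨rfl, rfl⟩

/-- Replacing the first letter of a cyclic word by its inverse, if it denotes an involution. -/
theorem detects_of_flip {Z : Type*} [CommGroup Z] (hZ : NoSmallTorsion Z) {H : Type*}
    [Group H] {g : ℕ → H} {i : ℕ} (hi : i < 2) (hg : g i * g i = 1) {w : ℕ → ℕ}
    (hw : IsCyclicWord 60 g w) (hw0 : w 0 = 2 * i) : Detects Z g i := by
  intro z hz
  by_cases hne : wordProd z w 60 = 1
  swap
  · exact ⟨w, hw, hne⟩
  refine ⟨Function.update w 0 (2 * i + 1), hw.congr fun k => ?_, fun h => hz ?_⟩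
  · by_cases hk : k = 0
    · rw [hk, Function.update_self, hw0, (letterVal_two_mul g hi).1, (letterVal_two_mul g hi).2]
      exact inv_eq_of_mul_eq_one_left hg
    · rw [Function.update_of_ne hk]
  -- If both words had trivial product, cancelling the common tail would give `z i = (z i)⁻¹`, a
  -- 2-torsion element.
  · rw [wordProd_succ'] at h hne
    have hsh : (fun k => Function.update w 0 (2 * i + 1) (k + 1)) = fun k => w (k + 1) := by
      ext k; exact Function.update_of_ne (by omega) _ _
    rw [Function.update_self, hsh, (letterVal_two_mul z hi).2] at h
    rw [hw0, (letterVal_two_mul z hi).1, ← h] at hne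
    refine hZ 2 (by norm_num) _ ?_
    rw [zpow_ofNat, pow_two]
    exact mul_eq_one_iff_eq_inv.2 (mul_right_cancel hne)

/-- The exponents that the letter `l` contributes to the three generators. -/
def letterNet : ℕ → ℤ × ℤ × ℤ
  | 0 => (1, 0, 0)
  | 1 => (-1, 0, 0)
  | 2 => (0, 1, 0)
  | 3 => (0, -1, 0)
  | 4 => (0, 0, 1)
  | _ => (0, 0, -1)

/-- The exponents of the three generators in the abelianization of a word. -/
def wordNet (w : ℕ → ℕ) : ℕ → ℤ × ℤ × ℤ
  | 0 => 0
  | n + 1 => wordNet w n + letterNet (w n)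

theorem letterVal_eq_zpow {Z : Type*} [CommGroup Z] (z : ℕ → Z) (l : ℕ) :
    letterVal z l = z 0 ^ (letterNet l).1 * z 1 ^ (letterNet l).2.1 * z 2 ^ (letterNet l).2.2 := by
  unfold letterVal letterNet
  split <;> simp

theorem wordProd_eq_zpow {Z : Type*} [CommGroup Z] (z : ℕ → Z) (w : ℕ → ℕ) (n : ℕ) :
    wordProd z w n =
      z 0 ^ (wordNet w n).1 * z 1 ^ (wordNet w n).2.1 * z 2 ^ (wordNet w n).2.2 := by
  induction n with
  | zero => simp [wordProd, wordNet]
  | succ n ih =>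
    rw [wordProd_succ, ih, letterVal_eq_zpow, wordNet]
    simp only [Prod.fst_add, Prod.snd_add, zpow_add]
    simp only [mul_assoc, mul_comm, mul_left_comm]

/-- If both products in `Z` were trivial, so would be their combination with exponents `c₁` and
`c₂`. The exponents of `z 1` and `z 2` cancel there, and a power of `z 0` with exponent dividing
6469693230 is left. -/
theorem detects_of_net {Z : Type*} [CommGroup Z] (hZ : NoSmallTorsion Z) {H : Type*} [Group H]
    {g : ℕ → H} {w₁ w₂ : ℕ → ℕ} (h₁ : IsCyclicWord 60 g w₁) (h₂ : IsCyclicWord 60 g w₂) (c₁ c₂ : ℤ)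
    (hdvd : (c₁ • wordNet w₁ 60 + c₂ • wordNet w₂ 60).1 ∣ 6469693230)
    (hzero : (c₁ • wordNet w₁ 60 + c₂ • wordNet w₂ 60).2 = 0) : Detects Z g 0 := by
  intro z hz
  by_contra hcon
  push Not at hcon
  refine hz (hZ _ hdvd _ ?_)
  have e : wordProd z w₁ 60 ^ c₁ * wordProd z w₂ 60 ^ c₂ = 1 := by
    rw [hcon _ h₁, hcon _ h₂, one_zpow, one_zpow, one_mul]
  have hz1 := congrArg Prod.fst hzero
  have hz2 := congrArg Prod.snd hzero
  simp only [Prod.snd_add, Prod.smul_snd, Prod.fst_add, Prod.smul_fst, smul_eq_mul, Prod.fst_zero,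
    Prod.snd_zero] at hz1 hz2 ⊢
  calc z 0 ^ (c₁ * (wordNet w₁ 60).1 + c₂ * (wordNet w₂ 60).1)
      = z 0 ^ (c₁ * (wordNet w₁ 60).1 + c₂ * (wordNet w₂ 60).1)
        * z 1 ^ (c₁ * (wordNet w₁ 60).2.1 + c₂ * (wordNet w₂ 60).2.1)
        * z 2 ^ (c₁ * (wordNet w₁ 60).2.2 + c₂ * (wordNet w₂ 60).2.2) := by
        rw [hz1, hz2]; simp
    _ = wordProd z w₁ 60 ^ c₁ * wordProd z w₂ 60 ^ c₂ := by
        simp only [wordProd_eq_zpow, mul_zpow, ← zpow_mul, zpow_add, mul_comm c₁, mul_comm c₂]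
        simp only [mul_assoc, mul_comm, mul_left_comm]
    _ = 1 := e

theorem check_net :
    ((netWords ++ netWordsTriple.map Prod.snd).all fun w =>
      decide ((wordNet (octLetters w) 60).1 ∣ 6469693230 ∧ (wordNet (octLetters w) 60).2 = 0)) =
        true := by
  decide +kernel

theorem check_net_pairs :
    (netPairs.all fun q => decide
      ((q.1 • wordNet (octLetters q.2.1) 60 + q.2.2.1 • wordNet (octLetters q.2.2.2) 60).1 ∣
          6469693230 ∧
        (q.1 • wordNet (octLetters q.2.1) 60 + q.2.2.1 • wordNet (octLetters q.2.2.2) 60).2 =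
          0)) = true := by
  decide +kernel

theorem check_flip :
    ((flipWords ++ flipWordsTriple.map Prod.snd).all fun w => Nat.beq (octLetters w 0) 0) = true := by
  decide +kernel

/-- The generators `a, b, c, c, c, …`. -/
def tripleGen {H : Type*} (a b c : H) : ℕ → H
  | 0 => a
  | 1 => b
  | _ => c

theorem tripleGen_mem {H : Type*} {X : Set H} {a b c : H} (ha : a ∈ X) (hb : b ∈ X) (hc : c ∈ X)
    (i : ℕ) : tripleGen a b c i ∈ X := by
  unfold tripleGen; split <;> assumption

theorem anyCyclic_sound {words : List ℕ} {a b : alternatingGroup (Fin 5)}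
    (h : anyCyclic words (permCode a) (permCode b) = true) :
    ∃ w ∈ words, IsCyclicWord 60 (tripleGen a b b) (octLetters w) := by
  rw [anyCyclic, strictApply_eq] at h
  obtain ⟨w, hw, h⟩ := List.any_eq_true.1 h
  exact ⟨w, hw, isCyclicWord_of_tableCyclic (tripleGen a b b) w h⟩

theorem anyCyclicPair_sound {pairs : List (ℤ × ℕ × ℤ × ℕ)} {a b : alternatingGroup (Fin 5)}
    (h : anyCyclicPair pairs (permCode a) (permCode b) = true) :
    ∃ q ∈ pairs, IsCyclicWord 60 (tripleGen a b b) (octLetters q.2.1) ∧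
      IsCyclicWord 60 (tripleGen a b b) (octLetters q.2.2.2) := by
  rw [anyCyclicPair, strictApply_eq] at h
  obtain ⟨q, hq, h⟩ := List.any_eq_true.1 h
  rw [Bool.and_eq_true] at h
  exact ⟨q, hq, isCyclicWord_of_tableCyclic (tripleGen a b b) _ h.1,
    isCyclicWord_of_tableCyclic (tripleGen a b b) _ h.2⟩

/-- The signature of orders only spares useless evaluations; soundness rests on the cyclicity test
alone. -/
theorem anyCyclicTriple_sound {words : List (ℕ × ℕ)} {a b c : alternatingGroup (Fin 5)}
    (h : anyCyclicTriple words (permCode a) (permCode b) (permCode c) = true) :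
    ∃ w ∈ words.map Prod.snd, IsCyclicWord 60 (tripleGen a b c) (octLetters w) := by
  rw [anyCyclicTriple, strictApply_eq, strictApply_eq] at h
  obtain ⟨q, hq, h⟩ := List.any_eq_true.1 h
  rw [Bool.and_eq_true] at h
  exact ⟨q.2, List.mem_map_of_mem hq, isCyclicWord_of_tableCyclic (tripleGen a b c) _ h.2⟩

theorem detects_of_net_word {Z : Type*} [CommGroup Z] (hZ : NoSmallTorsion Z) {H : Type*} [Group H]
    {g : ℕ → H} {w : ℕ} (hmem : w ∈ netWords ++ netWordsTriple.map Prod.snd)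
    (hw : IsCyclicWord 60 g (octLetters w)) : Detects Z g 0 := by
  obtain ⟨h1, h2⟩ := of_decide_eq_true (List.all_eq_true.1 check_net w hmem)
  -- A single word is treated as a pair with the coefficients 1 and 0.
  refine detects_of_net hZ hw hw 1 0 ?_ ?_
  · simpa using h1
  · simpa using h2

theorem detects_of_net_pair {Z : Type*} [CommGroup Z] (hZ : NoSmallTorsion Z) {H : Type*} [Group H]
    {g : ℕ → H} {q : ℤ × ℕ × ℤ × ℕ} (hmem : q ∈ netPairs)
    (h₁ : IsCyclicWord 60 g (octLetters q.2.1)) (h₂ : IsCyclicWord 60 g (octLetters q.2.2.2)) :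
    Detects Z g 0 := by
  obtain ⟨h1, h2⟩ := of_decide_eq_true (List.all_eq_true.1 check_net_pairs q hmem)
  exact detects_of_net hZ h₁ h₂ _ _ h1 h2

theorem detects_of_flip_word {Z : Type*} [CommGroup Z] (hZ : NoSmallTorsion Z) {H : Type*}
    [Group H] {g : ℕ → H} {w : ℕ} (hmem : w ∈ flipWords ++ flipWordsTriple.map Prod.snd)
    (hg : g 0 * g 0 = 1) (hw : IsCyclicWord 60 g (octLetters w)) : Detects Z g 0 :=
  detects_of_flip hZ (by norm_num) hg hw
    (Nat.eq_of_beq_eq_true (List.all_eq_true.1 check_flip w hmem))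

/-! ### Generating sets of the alternating group -/

/-- The stabilizer of the unordered pair `{r, r⁻¹}` under conjugation. -/
def invertingSubgroup {H : Type*} [Group H] (r : H) : Subgroup H where
  carrier := {b | b * r * b⁻¹ = r ∨ b * r * b⁻¹ = r⁻¹}
  one_mem' := by simp
  mul_mem' := by
    rintro x y hx hy
    have e : x * y * r * (x * y)⁻¹ = x * (y * r * y⁻¹) * x⁻¹ := by group
    have e' : x * r⁻¹ * x⁻¹ = (x * r * x⁻¹)⁻¹ := by group
    simp only [Set.mem_ofPred_eq, e] at *
    rcases hy with hy | hy <;> rcases hx with hx | hx <;> simp [hy, hx, e']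
  inv_mem' := by
    rintro x hx
    simp only [Set.mem_ofPred_eq] at *
    have e' : x⁻¹ * r⁻¹ * x⁻¹⁻¹ = (x⁻¹ * r * x⁻¹⁻¹)⁻¹ := by group
    rcases hx with hx | hx
    · left
      conv_lhs => rw [← hx]
      group
    · right
      rw [← inv_inj, ← e', inv_inv r, ← hx]
      group

theorem codeInverts_iff (r b : alternatingGroup (Fin 5)) :
    codeInverts (permCode r) (permCode b) = true ↔ b ∈ invertingSubgroup r := by
  rw [codeInverts, strictApply_eq, Bool.or_eq_true, Nat.beq_eq, Nat.beq_eq, ← permCode_inv,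
    ← permCode_mul, ← permCode_mul, ← permCode_mul, permCode_injective.eq_iff,
    permCode_injective.eq_iff]
  change _ ↔ b * r * b⁻¹ = r ∨ b * r * b⁻¹ = r⁻¹
  rw [mul_inv_eq_iff_eq_mul, mul_inv_eq_iff_eq_mul]
  norm_cast

theorem codeFixes_iff (i : Fin 5) (b : alternatingGroup (Fin 5)) :
    codeFixes i (permCode b) = true ↔ b ∈ MulAction.stabilizer (alternatingGroup (Fin 5)) i := by
  rw [codeFixes, Nat.beq_eq, octDigit_permCode, ← Fin.ext_iff]
  rfl

theorem exists_mem_notMem {H : Type*} [Group H] {X : Set H} (hX : Subgroup.closure X = ⊤)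
    (K : Subgroup H) (hK : ∃ g, g ∉ K) : ∃ x ∈ X, x ∉ K := by
  by_contra! h
  obtain ⟨g, hg⟩ := hK
  have : Subgroup.closure X ≤ K := (Subgroup.closure_le K).2 h
  exact hg (this (hX ▸ Subgroup.mem_top g))

theorem exists_codeFixes_eq_false {X : Set (alternatingGroup (Fin 5))}
    (hX : Subgroup.closure X = ⊤) (i : Fin 5) : ∃ x ∈ X, codeFixes i (permCode x) = false := by
  obtain ⟨x, hx, h⟩ := exists_mem_notMem hX (MulAction.stabilizer (alternatingGroup (Fin 5)) i) (by
    -- The 5-cycle `(0 1 2 3 4)` lies in no point stabilizer.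
    obtain ⟨g, hg⟩ := exists_permCode_eq (c := 0o04321) (by decide)
    refine ⟨g, fun h => ?_⟩
    rw [← codeFixes_iff, hg] at h
    revert h; revert i; decide)
  exact ⟨x, hx, by rwa [← codeFixes_iff, Bool.not_eq_true] at h⟩

theorem exists_codeInverts_eq_false {X : Set (alternatingGroup (Fin 5))}
    (hX : Subgroup.closure X = ⊤) {r : ℕ} (hr : r ∈ 0o43021 :: 0o04321 :: 0o10432 :: invertedCodes) :
    ∃ x ∈ X, codeInverts r (permCode x) = false := by
  have h := List.all_eq_true.1 check_exists_not_inverts r hr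
  rw [Bool.and_eq_true, List.contains_iff_mem] at h
  obtain ⟨r', rfl⟩ := exists_permCode_eq h.1
  obtain ⟨b, hb, hb'⟩ := List.any_eq_true.1 h.2
  obtain ⟨g, rfl⟩ := exists_permCode_eq hb
  obtain ⟨x, hx, h⟩ := exists_mem_notMem hX (invertingSubgroup r') ⟨g, fun h => by
    rw [← codeInverts_iff] at h; simp [h] at hb'⟩
  exact ⟨x, hx, by rwa [← codeInverts_iff, Bool.not_eq_true] at h⟩

/-! ### Suitable cycles for each conjugacy class -/

/-- The generator `g 0` has order three, lifts of `g 1` outside the first factor are detected, and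
`blockWord` is a cyclic word. -/
def IsBlockGen (Z : Type*) [CommGroup Z] {H : Type*} [Group H] (g : ℕ → H) : Prop :=
  orderOf (g 0) = 3 ∧ Detects Z g 1 ∧ IsCyclicWord 60 g (octLetters blockWord)

theorem IsBlockGen.map_equiv {Z : Type*} [CommGroup Z] {H K : Type*} [Group H] [Group K]
    {g : ℕ → H} (h : IsBlockGen Z g) (φ : H ≃* K) : IsBlockGen Z (fun j => φ (g j)) :=
  ⟨(MulEquiv.orderOf_eq φ (g 0)).trans h.1, h.2.1.map_equiv φ, h.2.2.map_equiv φ⟩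

/-- Some generators in `X`, the first of them being `s`, give suitable hamiltonian cycles. -/
def HasCycles (Z : Type*) [CommGroup Z] {H : Type*} [Group H] (X : Set H) (s : H) : Prop :=
  ∃ g : ℕ → H, g 0 = s ∧ (∀ i, g i ∈ X) ∧ (Detects Z g 0 ∨ IsBlockGen Z g)

theorem hasCycles_of_order_five {Z : Type*} [CommGroup Z] (hZ : NoSmallTorsion Z)
    {X : Set (alternatingGroup (Fin 5))} (hX : Subgroup.closure X = ⊤)
    {s : alternatingGroup (Fin 5)} (hs : s ∈ X) (hcode : permCode s ∈ [0o04321, 0o10432]) :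
    HasCycles Z X s := by
  obtain ⟨b, hb, hinv⟩ := exists_codeInverts_eq_false hX (r := permCode s)
    (by revert hcode; generalize permCode s = n; revert n; decide)
  have h := List.all_eq_true.1 (List.all_eq_true.1 check_order_five _ hcode) _
    (permCode_mem_evenCodes b)
  rw [hinv, Bool.false_or, Bool.or_eq_true] at h
  refine ⟨tripleGen s b b, rfl, tripleGen_mem hs hb hb, Or.inl ?_⟩
  rcases h with h | h
  · obtain ⟨w, hw, h⟩ := anyCyclic_sound h
    exact detects_of_net_word hZ (List.mem_append_left _ hw) h
  · obtain ⟨q, hq, h₁, h₂⟩ := anyCyclicPair_sound h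
    exact detects_of_net_pair hZ hq h₁ h₂

theorem hasCycles_of_order_three_pair {Z : Type*} [CommGroup Z] (hZ : NoSmallTorsion Z)
    {X : Set (alternatingGroup (Fin 5))} {s b : alternatingGroup (Fin 5)} (hs : s ∈ X) (hb : b ∈ X)
    (hcode : permCode s = 0o43021) (hprop : properOrderThree (permCode b) = false) :
    HasCycles Z X s := by
  have h := List.all_eq_true.1 check_order_three_pair _ (permCode_mem_evenCodes b)
  rw [hprop, Bool.false_or, Bool.or_eq_true, Bool.or_eq_true, ← hcode] at h
  refine ⟨tripleGen s b b, rfl, tripleGen_mem hs hb hb, ?_⟩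
  rcases h with h | h | h
  · obtain ⟨w, hw, h⟩ := anyCyclic_sound h
    exact Or.inl (detects_of_net_word hZ (List.mem_append_left _ hw) h)
  · obtain ⟨q, hq, h₁, h₂⟩ := anyCyclicPair_sound h
    exact Or.inl (detects_of_net_pair hZ hq h₁ h₂)
  · rw [Bool.and_eq_true, Nat.beq_eq, ← permCode_mul, ← permCode_one,
      permCode_injective.eq_iff] at h
    obtain ⟨w, hw, h2⟩ := anyCyclic_sound h.2
    rw [List.mem_singleton.1 hw] at h2
    -- Since `b` is an involution and `blockWord` begins with the letter 2, flipping that letter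
    -- detects the second generator.
    refine Or.inr ⟨?_, detects_of_flip hZ (by norm_num) (by exact_mod_cast h.1) h2 (by decide), h2⟩
    have hne : s ≠ 1 := by
      rintro rfl
      have := permCode_one ▸ hcode
      revert this; decide
    refine orderOf_eq_prime ?_ hne
    refine Subtype.ext (permCode_injective ?_)
    change permCode ((s : Perm (Fin 5)) ^ 3) = permCode 1
    rw [pow_succ, pow_two, permCode_mul, permCode_mul, hcode, permCode_one]
    decide

theorem hasCycles_of_order_three {Z : Type*} [CommGroup Z] (hZ : NoSmallTorsion Z)
    {X : Set (alternatingGroup (Fin 5))} (hX : Subgroup.closure X = ⊤)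
    {s : alternatingGroup (Fin 5)} (hs : s ∈ X) (hcode : permCode s = 0o43021) :
    HasCycles Z X s := by
  by_cases hpair : ∃ b ∈ X, properOrderThree (permCode b) = false
  · obtain ⟨b, hb, hprop⟩ := hpair
    exact hasCycles_of_order_three_pair hZ hs hb hcode hprop
  push Not at hpair
  simp only [ne_eq, Bool.not_eq_false] at hpair
  -- Every element of `X` now lies in one of the three maximal subgroups. One outside the normalizer
  -- must fix 3 or 4, and another one moves that point.
  obtain ⟨d, hd, hinv⟩ := exists_codeInverts_eq_false hX (r := 0o43021) (by simp)
  obtain ⟨i, hi, hdi⟩ : ∃ i : Fin 5, (i : ℕ) ∈ [3, 4] ∧ codeFixes i (permCode d) = true := by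
    have := hpair d hd
    rw [properOrderThree, hinv, Bool.or_false, Bool.or_eq_true] at this
    rcases this with h | h
    · exact ⟨3, by decide, h⟩
    · exact ⟨4, by decide, h⟩
  obtain ⟨b, hb, hbi⟩ := exists_codeFixes_eq_false hX i
  have h := List.all_eq_true.1 (List.all_eq_true.1 check_order_three_triple _ hi) _
    (permCode_mem_evenCodes d)
  rw [hdi, hinv, Bool.not_true, Bool.false_or, Bool.false_or] at h
  have h := List.all_eq_true.1 h _ (permCode_mem_evenCodes b)
  rw [hbi, hpair b hb, Bool.not_true, Bool.false_or, Bool.false_or, ← hcode] at h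
  obtain ⟨w, hw, h⟩ := anyCyclicTriple_sound h
  exact ⟨tripleGen s d b, rfl, tripleGen_mem hs hd hb,
    Or.inl (detects_of_net_word hZ (List.mem_append_right _ hw) h)⟩

theorem hasCycles_of_order_two {Z : Type*} [CommGroup Z] (hZ : NoSmallTorsion Z)
    {X : Set (alternatingGroup (Fin 5))} (hX : Subgroup.closure X = ⊤)
    {s : alternatingGroup (Fin 5)} (hs : s ∈ X) (hcode : permCode s = 0o42301) :
    HasCycles Z X s := by
  have hss : s * s = 1 := by
    refine Subtype.ext (permCode_injective ?_)
    change permCode ((s : Perm (Fin 5)) * s) = permCode 1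
    rw [permCode_mul, hcode, permCode_one]
    decide
  by_cases hpair : ∃ b ∈ X, properOrderTwo (permCode b) = false
  · obtain ⟨b, hb, hprop⟩ := hpair
    have h := List.all_eq_true.1 check_order_two_pair _ (permCode_mem_evenCodes b)
    rw [hprop, Bool.false_or, ← hcode] at h
    obtain ⟨w, hw, h⟩ := anyCyclic_sound h
    exact ⟨tripleGen s b b, rfl, tripleGen_mem hs hb hb,
      Or.inl (detects_of_flip_word hZ (List.mem_append_left _ hw) hss h)⟩
  push Not at hpair
  simp only [ne_eq, Bool.not_eq_false] at hpair
  -- Without a single partner, an element moving 4 must lie in one of the four normalizers; an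
  -- element outside that normalizer completes the triple.
  obtain ⟨b, hb, hb4⟩ := exists_codeFixes_eq_false hX 4
  obtain ⟨r, hr, hbr⟩ : ∃ r ∈ invertedCodes, codeInverts r (permCode b) = true := by
    have := hpair b hb
    rw [properOrderTwo, show codeFixes 4 (permCode b) = false from hb4, Bool.false_or] at this
    exact List.any_eq_true.1 this
  obtain ⟨c, hc, hcr⟩ := exists_codeInverts_eq_false hX
    (List.mem_cons_of_mem _ (List.mem_cons_of_mem _ (List.mem_cons_of_mem _ hr)))
  have h := List.all_eq_true.1 (List.all_eq_true.1 check_order_two_triple _ hr) _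
    (permCode_mem_evenCodes b)
  rw [show codeFixes 4 (permCode b) = false from hb4, hbr, Bool.not_true, Bool.false_or,
    Bool.false_or] at h
  have h := List.all_eq_true.1 h _ (permCode_mem_evenCodes c)
  rw [hcr, hpair c hc, Bool.not_true, Bool.false_or, Bool.false_or, ← hcode] at h
  obtain ⟨w, hw, h⟩ := anyCyclicTriple_sound h
  exact ⟨tripleGen s b c, rfl, tripleGen_mem hs hb hc,
    Or.inl (detects_of_flip_word hZ (List.mem_append_right _ hw) hss h)⟩

/-- Conjugation carries `s` to one of the four representatives and `X` to another generating set;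
the cycles found there are carried back by the inverse automorphism. -/
theorem hasCycles_of_ne_one {Z : Type*} [CommGroup Z] (hZ : NoSmallTorsion Z)
    {X : Set (alternatingGroup (Fin 5))} (hX : Subgroup.closure X = ⊤)
    {s : alternatingGroup (Fin 5)} (hs : s ∈ X) (hne : s ≠ 1) : HasCycles Z X s := by
  obtain ⟨t, ht⟩ := exists_conj_eq s hne
  set φ := MulAut.conj t with hφ
  have hX' : Subgroup.closure (φ '' X) = ⊤ := by
    have := MonoidHom.map_closure φ.toMonoidHom X
    rw [hX, Subgroup.map_top_of_surjective _ φ.surjective] at this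
    exact this.symm
  have hs' : φ s ∈ φ '' X := Set.mem_image_of_mem _ hs
  have h : HasCycles Z (φ '' X) (φ s) := by
    simp only [List.mem_cons, List.not_mem_nil, or_false] at ht
    rcases ht with h | h | h | h
    · exact hasCycles_of_order_two hZ hX' hs' h
    · exact hasCycles_of_order_three hZ hX' hs' h
    · exact hasCycles_of_order_five hZ hX' hs' (by rw [hφ, MulAut.conj_apply, h]; simp)
    · exact hasCycles_of_order_five hZ hX' hs' (by rw [hφ, MulAut.conj_apply, h]; simp)
  obtain ⟨g, hg0, hg, h⟩ := h
  refine ⟨fun i => φ.symm (g i), (congrArg φ.symm hg0).trans (φ.symm_apply_apply s), fun i => ?_, ?_⟩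
  · obtain ⟨x, hx, hxi⟩ := hg i
    change φ.symm (g i) ∈ X
    rw [← hxi, φ.symm_apply_apply]; exact hx
  · exact h.imp (fun h => h.map_equiv φ.symm) fun h => h.map_equiv φ.symm

/-! ### The main theorem -/

theorem noSmallTorsion_of_card {Z : Type*} [CommGroup Z] [Fintype Z] {p : ℕ} (hp : p.Prime)
    (hp30 : p ≡ 1 [MOD 30]) (hZ : Fintype.card Z = p) : NoSmallTorsion Z := by
  intro D hD z hz
  by_contra hne
  have h1 := orderOf_dvd_iff_zpow_eq_one.2 hz
  rw [orderOf_eq_of_card_prime hp hZ hne] at h1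
  have h2 : p ∣ 2 * 3 * 5 * 7 * 11 * 13 * 17 * 19 * 23 * 29 := by
    have := h1.trans hD
    exact_mod_cast this
  have hlt : p < 30 := by
    simp only [hp.dvd_mul] at h2
    have hle : ∀ n, 0 < n → n < 30 → p ∣ n → p < 30 := fun n hn h h' =>
      lt_of_le_of_lt (Nat.le_of_dvd hn h') h
    rcases h2 with ((((((((h | h) | h) | h) | h) | h) | h) | h) | h) | h <;>
      exact hle _ (by norm_num) (by norm_num) h
  -- A prime congruent to 1 modulo 30 is at least 31, since below 30 only 1 has this residue.
  have : p = 1 := by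
    have h := hp30
    rw [Nat.ModEq, Nat.mod_eq_of_lt hlt] at h
    exact h
  exact hp.one_lt.ne' this

theorem SimpleGraph.closure_eq_top_of_mulCayley_connected {G : Type*} [Group G] (S : Set G)
    (h : (SimpleGraph.mulCayley S).Connected) : Subgroup.closure S = ⊤ := by
  have key : ∀ u v : G, (SimpleGraph.mulCayley S).Walk u v → u⁻¹ * v ∈ Subgroup.closure S := by
    intro u v p
    induction p with
    | nil => simp
    | @cons u v w hadj p ih =>
      rw [SimpleGraph.mulCayley_adj] at hadj
      have h1 : u⁻¹ * v ∈ Subgroup.closure S := by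
        rcases hadj.2 with h | h
        · exact Subgroup.subset_closure h
        · simpa using Subgroup.inv_mem _ (Subgroup.subset_closure h)
      simpa [mul_assoc] using Subgroup.mul_mem _ h1 ih
  refine (Subgroup.eq_top_iff' _).2 fun g => ?_
  obtain ⟨p⟩ := h.preconnected 1 g
  simpa using key 1 g p

/-- The signs of the blocks of `blockWord`. -/
def blockSign (j : ℕ) : ℤ := if octLetters blockWord (3 * j + 1) = 0 then 1 else -1

theorem SimpleGraph.mulCayley_hamiltonian_of_isBlockGen {Z : Type*} [CommGroup Z] [Fintype Z]
    [DecidableEq Z] (p : ℕ) [Fact p.Prime] (hp3 : p ≠ 3) (hZ : Fintype.card Z = p)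
    (S : Set (alternatingGroup (Fin 5) × Z)) (γ : ℕ → alternatingGroup (Fin 5) × Z)
    (hγ : ∀ i, γ i ∈ S) (hγ0 : (γ 0).2 ≠ 1) (h : IsBlockGen Z fun i => (γ i).1) :
    ∃ (v : _) (C : (SimpleGraph.mulCayley S).Walk v v), C.IsHamiltonianCycle := by
  obtain ⟨hord, hdet, hw⟩ := h
  by_cases hγ1 : (γ 1).2 = 1
  -- The word has 20 blocks, ten of each sign. When the second generator lies outside A_5, its own
  -- detection applies instead.
  · refine mulCayley_hamiltonian_of_blocks p hp3 hZ 20 (by norm_num) card_alternatingGroup_five S γ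
      hγ _ hw hord hγ0 hγ1 blockSign ?_ ?_ ?_ ?_ ?_
    · intro j
      unfold blockSign
      split <;> simp
    · decide +kernel
    · decide +kernel
    · decide +kernel
    · decide +kernel
  · obtain ⟨w, hw, hne⟩ := hdet (fun i => (γ i).2) hγ1
    have hc := card_alternatingGroup_five
    exact mulCayley_hamiltonian_of_wordProd_ne_one p hZ (by omega) S γ hγ w (by rwa [hc])
      (by rwa [hc])

theorem mainTheorem1 (p : ℕ) (hp : p.Prime) (hp30 : p ≡ 1 [MOD 30])
    (S : Set (alternatingGroup (Fin 5) × Multiplicative (ZMod p)))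
    (hconn : (SimpleGraph.mulCayley S).Connected) :
    ∃ (v : alternatingGroup (Fin 5) × Multiplicative (ZMod p))
      (C : (SimpleGraph.mulCayley S).Walk v v), C.IsHamiltonianCycle := by
  have : Fact p.Prime := ⟨hp⟩
  have hZ : Fintype.card (Multiplicative (ZMod p)) = p := by
    rw [Fintype.card_multiplicative, ZMod.card]
  have hp2 : p ≠ 2 := by rintro rfl; revert hp30; decide
  have hp3 : p ≠ 3 := by rintro rfl; revert hp30; decide
  have hc := card_alternatingGroup_five
  have htors := noSmallTorsion_of_card hp hp30 hZ
  have hS := SimpleGraph.closure_eq_top_of_mulCayley_connected S hconn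
  have hX : Subgroup.closure (Prod.fst '' S) = ⊤ := by
    have := MonoidHom.map_closure (MonoidHom.fst (alternatingGroup (Fin 5))
      (Multiplicative (ZMod p))) S
    rw [hS, Subgroup.map_top_of_surjective _ Prod.fst_surjective] at this
    exact this.symm
  have hlift : ∀ s ∈ S, s.1 ≠ 1 → ∃ γ : ℕ → alternatingGroup (Fin 5) × Multiplicative (ZMod p),
      γ 0 = s ∧ (∀ i, γ i ∈ S) ∧ (Detects (Multiplicative (ZMod p)) (fun i => (γ i).1) 0 ∨
        IsBlockGen (Multiplicative (ZMod p)) fun i => (γ i).1) := by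
    intro s hs hne
    obtain ⟨g, hg0, hg, h⟩ := hasCycles_of_ne_one htors hX (Set.mem_image_of_mem _ hs) hne
    choose γ hγ hγg using hg
    -- The lift at index 0 is forced to be `s` itself: another lift of `s.1` in `S` might have a
    -- different component in `Z`.
    refine ⟨fun i => if i = 0 then s else γ i, by simp, fun i => ?_, ?_⟩
    · by_cases hi : i = 0 <;> simp [hi, hs, hγ]
    · have e : (fun i => (if i = 0 then s else γ i).1) = g := by
        ext1 i
        by_cases hi : i = 0
        · simp [hi, hg0]
        · simp [hi, hγg]
      rwa [e]
  obtain ⟨s, hs, hs2⟩ : ∃ s ∈ S, s.2 ≠ 1 := by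
    obtain ⟨x, hx, h⟩ := exists_mem_notMem hS
      (MonoidHom.ker (MonoidHom.snd (alternatingGroup (Fin 5)) (Multiplicative (ZMod p))))
      ⟨(1, Multiplicative.ofAdd 1), fun h => one_ne_zero (α := ZMod p) h⟩
    exact ⟨x, hx, h⟩
  by_cases hs1 : s.1 = 1
  · obtain ⟨x, ⟨t, ht, rfl⟩, hx⟩ := exists_mem_notMem hX ⊥ (by
      by_contra! h
      have : Subsingleton (alternatingGroup (Fin 5)) :=
        ⟨fun a b => (Subgroup.mem_bot.1 (h a)).trans (Subgroup.mem_bot.1 (h b)).symm⟩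
      have := Fintype.card_le_one_iff_subsingleton.2 this
      omega)
    obtain ⟨γ, -, hγ, h⟩ := hlift t ht fun h => hx (Subgroup.mem_bot.2 h)
    obtain ⟨w, hw⟩ : ∃ w, IsCyclicWord 60 (fun i => (γ i).1) w := by
      rcases h with h | h
      -- Here `Detects` only serves to produce some cyclic word, so any nontrivial assignment in `Z`
      -- will do.
      · obtain ⟨w, hw, -⟩ := h (fun _ => s.2) hs2
        exact ⟨w, hw⟩
      · exact ⟨_, h.2.2⟩
    exact SimpleGraph.mulCayley_hamiltonian_of_central p hp2 hZ (by omega)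
      (by rw [hc]; decide) S s hs hs1 hs2 γ hγ w (by rwa [hc])
  · obtain ⟨γ, hγ0, hγ, h | h⟩ := hlift s hs hs1
    · obtain ⟨w, hw, hne⟩ := h (fun i => (γ i).2) (by rwa [hγ0])
      exact SimpleGraph.mulCayley_hamiltonian_of_wordProd_ne_one p hZ (by omega) S γ hγ w
        (by rwa [hc]) (by rwa [hc])
    · exact SimpleGraph.mulCayley_hamiltonian_of_isBlockGen p hp3 hZ S γ hγ (by rwa [hγ0]) h
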